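/- Let $\Delta$ be a simplicial complex with finite nonempty vertex set $V$ (so $\{v\}\in\Delta$ for all $v\in V$), let $k$ be a field and $R=k[x_v : v\in V]$. A facet is a maximal face. A facet $F$ is a \emph{leaf} if it is the only facet, or if there is a facet $G\ne F$, called a \emph{joint} of $F$, with $F\cap H\subseteq G$ for all facets $H\neq F$. The complex $\Delta$ is a \emph{simplicial tree} if it is connected and, for every nonempty set $S$ of facets of $\Delta$, the complex $\langle S\rangle$ generated by $S$ has a leaf. Suppose that $\Delta$ is a simplicial tree. Then the following are equivalent: 1. $\Delta$ is unmixed, i.e. all minimal vertex covers of $\Delta$ (minimal sets of vertices meeting every facet) have the same cardinality; 2. $R/\mathcal F(\Delta)$ is a Cohen–Macaulay ring, where $\mathcal F(\Delta)=\big(\prod_{v\in F}x_v : F \text{ a facet of }\Delta\big)$ is the facet ideal; 3. $\Delta$ is grafted; 4. the independence complex $\mathrm{Ind}(\Delta)=\{W\subseteq V : W\text{ contains no facet of }\Delta\}$ is a generalized Bier ball; 5. $\mathrm{Ind}(\Delta)$ is vertex decomposable. In particular this applies to every graph that is a tree, regarded as a simplicial complex with faces $\emptyset$, the vertices and the edges,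 because such a complex is a simplicial tree. Here $\Delta$ is \emph{grafted} if its set of facets is a union $\{F_1,\dots,F_r\}\cup\{G_1,\dots,G_s\}$ of two disjoint families such that every $G_j$ is contained in $F_1\cup\dots\cup F_r$; $F_1,\dots,F_r$ are exactly the leaves of $\Delta$; $F_i\cap F_j=\emptyset$ for $i\ne j$; and, recursively, whenever $G_j$ is a joint of a leaf of $\Delta$, the complex generated by all facets of $\Delta$ other than $G_j$ is grafted. A complex is a \emph{generalized Bier ball} if, up to renaming vertices, it is the Stanley–Reisner complex of the polarization of an artinian monomial ideal $I\subseteq k[x_1,\dots,x_n]$ (for some $n$). The polarization is the ideal generated by the monomials $\prod_i x_{i,1}x_{i,2}\cdots x_{i,m_i}$ for $x_1^{m_1}\cdots x_n^{m_n}$ a minimal monomial generator of $I$, in the polynomial ring over $k$ whose variables are those that occur in these monomials. The Stanley–Reisner complex of a square-free monomial ideal $J$ consists of the sets of variables whose product is not in $J$. A complex $\Gamma$ on $V$ is \emph{vertex decomposable} if it is void, or a simplex (it has exactly one facet), or it is pure (all facets have the same dimension) and there is a vertex $v\in V$ such that every facet of the deletion $\{G\in\Gamma : v\notin G\}$ is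 a facet of $\Gamma$, and both this deletion and the link $\{G\in\Gamma : v\notin G,\ G\cup\{v\}\in\Gamma\}$ are vertex decomposable. -/

import Mathlib

/-!
A finite simplicial complex on a vertex set contained in a finite type `V` is a lower set of
finsets of `V`, i.e. a family of finite subsets closed under taking subsets.  The empty set counts
as a face; the void complex without any face is `⊥`.
-/

namespace SimplicialTrees

section Complexes

variable {V : Type*}

/-- A facet of `Δ`: a face that is maximal under inclusion. -/
def IsFacet (Δ : LowerSet (Finset V)) (F : Finset V) : Prop :=
  Maximal (fun E => E ∈ Δ) F

/-- The set of facets of `Δ`. -/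
def facets (Δ : LowerSet (Finset V)) : Set (Finset V) :=
  {F | IsFacet Δ F}

/-- `Δ` is pure: all facets have the same dimension. -/
def IsPure (Δ : LowerSet (Finset V)) : Prop :=
  ∀ F G, IsFacet Δ F → IsFacet Δ G → F.card = G.card

/-- The independence complex of `Δ`: the sets of vertices containing no facet of `Δ`. -/
def Ind (Δ : LowerSet (Finset V)) : LowerSet (Finset V) where
  carrier := {W | ∀ F, IsFacet Δ F → ¬ F ⊆ W}
  lower' := fun _ _ hle hW F hF hsub => hW F hF (hsub.trans hle)

/-- The complex obtained from `Δ` by removing the facet `G`: it is generated by the facets of `Δ`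
other than `G`. -/
def removeFacet (Δ : LowerSet (Finset V)) (G : Finset V) : LowerSet (Finset V) :=
  lowerClosure (facets Δ \ {G})

variable [DecidableEq V]

/-- The link of the face `F` in `Δ`. -/
def link (Δ : LowerSet (Finset V)) (F : Finset V) : LowerSet (Finset V) where
  carrier := {G | G ∈ Δ ∧ G ∪ F ∈ Δ ∧ G ∩ F = ∅}
  lower' := fun _ _ hle h =>
    ⟨Δ.lower hle h.1, Δ.lower (Finset.union_subset_union_left hle) h.2.1,
      Finset.subset_empty.mp ((Finset.inter_subset_inter_right hle).trans h.2.2.le)⟩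

/-- The deletion of the face `F` from `Δ`. -/
def deletion (Δ : LowerSet (Finset V)) (F : Finset V) : LowerSet (Finset V) where
  carrier := {G | G ∈ Δ ∧ G ∩ F = ∅}
  lower' := fun _ _ hle h =>
    ⟨Δ.lower hle h.1,
      Finset.subset_empty.mp ((Finset.inter_subset_inter_right hle).trans h.2.le)⟩

/-- (Pure) vertex decomposability: `Δ` is void, or a simplex (it has exactly one facet), or `Δ` is
pure and has a vertex `v` such that every facet of the deletion of `v` is a facet of `Δ` and both
the link and the deletion of `v` are vertex decomposable. -/
inductive IsVertexDecomposable : LowerSet (Finset V) → Prop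
  | void : IsVertexDecomposable ⊥
  | simplex (Δ : LowerSet (Finset V)) (h : ∃! F, IsFacet Δ F) : IsVertexDecomposable Δ
  | shed (Δ : LowerSet (Finset V)) (pure : IsPure Δ) (v : V)
      (shedding : ∀ F, IsFacet (deletion Δ {v}) F → IsFacet Δ F)
      (link_vd : IsVertexDecomposable (link Δ {v}))
      (deletion_vd : IsVertexDecomposable (deletion Δ {v})) : IsVertexDecomposable Δ

/-- `G` is a joint of the facet `F` of `Δ`: it is another facet of `Δ`, and it contains `F ∩ H`
for all facets `H ≠ F`. -/
def IsJointOf (Δ : LowerSet (Finset V)) (F G : Finset V) : Prop :=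
  IsFacet Δ F ∧ IsFacet Δ G ∧ G ≠ F ∧ ∀ H, IsFacet Δ H → H ≠ F → F ∩ H ⊆ G

/-- `F` is a leaf of `Δ`: it is the only facet, or it is a facet that has a joint. -/
def IsLeaf (Δ : LowerSet (Finset V)) (F : Finset V) : Prop :=
  IsFacet Δ F ∧ ((∀ H, IsFacet Δ H → H = F) ∨ ∃ G, IsJointOf Δ F G)

/-- `Δ` is connected: any two facets are joined by a chain of facets in which
consecutive facets meet. -/
def IsConnected (Δ : LowerSet (Finset V)) : Prop :=
  ∀ F G, IsFacet Δ F → IsFacet Δ G →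
    Relation.ReflTransGen (fun A B => IsFacet Δ A ∧ IsFacet Δ B ∧ (A ∩ B).Nonempty) F G

/-- `Δ` is a simplicial tree with vertex set `V`. -/
structure IsSimplicialTree (Δ : LowerSet (Finset V)) : Prop where
  nonempty : Nonempty V
  /-- The vertex set of `Δ` is all of `V`. -/
  vertex_mem : ∀ v : V, {v} ∈ Δ
  connected : IsConnected Δ
  /-- Every nonempty subcollection (the complex generated by some of the facets) has a leaf. -/
  exists_leaf : ∀ S : Set (Finset V), S ⊆ facets Δ → S.Nonempty →
    ∃ F, IsLeaf (lowerClosure S) F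

/-- `Δ` is a grafting of the complex with facets `Gs` with the simplices `Fs`, for some `Fs` and
`Gs`. -/
inductive IsGrafted : LowerSet (Finset V) → Prop
  | mk (Δ : LowerSet (Finset V)) (Fs Gs : Set (Finset V))
      (facets_eq : facets Δ = Fs ∪ Gs)
      (cover : ∀ G ∈ Gs, ∀ v ∈ G, ∃ F ∈ Fs, v ∈ F)
      (leaves : ∀ F, F ∈ Fs ↔ IsLeaf Δ F)
      (disjoint : Gs ∩ Fs = ∅)
      (pairwise_disjoint : ∀ F ∈ Fs, ∀ F' ∈ Fs, F ≠ F' → F ∩ F' = ∅)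
      (remove_joint : ∀ G ∈ Gs, (∃ F, IsLeaf Δ F ∧ IsJointOf Δ F G) →
        IsGrafted (removeFacet Δ G)) : IsGrafted Δ

/-- A vertex cover of `Δ`: a set of vertices that meets every facet. -/
def IsVertexCover (Δ : LowerSet (Finset V)) (C : Finset V) : Prop :=
  ∀ F, IsFacet Δ F → (F ∩ C).Nonempty

/-- `Δ` is unmixed: all minimal vertex covers have the same cardinality. -/
def IsUnmixed (Δ : LowerSet (Finset V)) : Prop :=
  ∀ C D, Minimal (IsVertexCover Δ) C → Minimal (IsVertexCover Δ) D → C.card = D.card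

/-- A graph as a simplicial complex of dimension at most one: the faces are the empty set, the
vertices and the edges.  When no vertex is isolated, the facets are exactly the edges. -/
def graphComplex (G : SimpleGraph V) : LowerSet (Finset V) where
  carrier := {F | F.card ≤ 1 ∨ ∃ u v, G.Adj u v ∧ F = {u, v}}
  lower' := by
    rintro A B hle (hA | ⟨u, v, huv, rfl⟩)
    · exact Or.inl ((Finset.card_le_card hle).trans hA)
    · by_cases hB : B = {u, v}
      · exact Or.inr ⟨u, v, huv, hB⟩
      · have h1 := Finset.card_lt_card (lt_of_le_of_ne hle hB)
        have h2 : ({u, v} : Finset V).card ≤ 2 := Finset.card_le_two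
        exact Or.inl (by omega)

end Complexes

section Rings

/-- The depth of a local ring: the supremum of the lengths of the regular sequences in its maximal
ideal. -/
noncomputable def localDepth (A : Type*) [CommRing A] [IsLocalRing A] : ℕ∞ :=
  ⨆ (rs : List A) (_ : RingTheory.Sequence.IsRegular A rs)
    (_ : ∀ r ∈ rs, r ∈ IsLocalRing.maximalIdeal A), (rs.length : ℕ∞)

/-- A Noetherian ring is Cohen–Macaulay if each localization at a maximal ideal has depth equal to
its Krull dimension. -/
def IsCohenMacaulay (A : Type*) [CommRing A] : Prop :=
  IsNoetherianRing A ∧ ∀ (m : Ideal A) [m.IsMaximal],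
    ((localDepth (Localization.AtPrime m) : ℕ∞) : WithBot ℕ∞)
      = ringKrullDim (Localization.AtPrime m)

end Rings

section Ideals

open MvPolynomial

variable {V : Type*} (k : Type*) [Field k]

/-- The facet ideal of `Δ` in `k[x_v : v ∈ V]`, generated by the products of the variables over
the facets. -/
noncomputable def facetIdeal (Δ : LowerSet (Finset V)) : Ideal (MvPolynomial V k) :=
  Ideal.span {p | ∃ F, IsFacet Δ F ∧ p = ∏ v ∈ F, X v}

variable {k}

/-- The Stanley–Reisner complex of an ideal `J` (meant to be a square-free monomial ideal): the
sets of variables whose product is not in `J`. -/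
def stanleyReisnerComplex (J : Ideal (MvPolynomial V k)) : LowerSet (Finset V) where
  carrier := {F | ∏ v ∈ F, (X v : MvPolynomial V k) ∉ J}
  lower' := fun _ _ hle hA hB => hA (J.mem_of_dvd (Finset.prod_dvd_prod_of_subset _ _ _ hle) hB)

/-- `I` is a monomial ideal: it is generated by monomials. -/
def IsMonomialIdeal (I : Ideal (MvPolynomial V k)) : Prop :=
  ∃ S : Set (V →₀ ℕ), I = Ideal.span ((fun m => monomial m (1 : k)) '' S)

/-- The exponents of the minimal monomial generators of a monomial ideal `I`: the monomials of `I`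
that are minimal under divisibility. -/
def minimalGenerators (I : Ideal (MvPolynomial V k)) : Set (V →₀ ℕ) :=
  {m | Minimal (fun m => monomial m (1 : k) ∈ I) m}

variable {n : ℕ}

/-- The variables `x_{i,j}` occurring in the polarizations of the minimal generators of `I`; the
second index starts at `0`. -/
abbrev PolarizationVar (I : Ideal (MvPolynomial (Fin n) k)) : Type :=
  {w : Fin n × ℕ // ∃ m ∈ minimalGenerators I, w.2 < m w.1}

/-- The polarization of a minimal generator `x^m` of `I`, namely
`∏ i, x_{i,0} x_{i,1} ⋯ x_{i,m_i - 1}`. -/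
noncomputable def polarizationMonomial (I : Ideal (MvPolynomial (Fin n) k))
    (m : minimalGenerators I) : MvPolynomial (PolarizationVar I) k :=
  ∏ i : Fin n, ∏ j : Fin (m.1 i), X ⟨(i, (j : ℕ)), m.1, m.2, j.2⟩

/-- The polarization of a monomial ideal `I`, generated by the polarizations of the minimal
generators of `I`. -/
noncomputable def polarization (I : Ideal (MvPolynomial (Fin n) k)) :
    Ideal (MvPolynomial (PolarizationVar I) k) :=
  Ideal.span (Set.range (polarizationMonomial I))

variable (k)

/-- `Γ` is a generalized Bier ball: up to a bijective renaming of the vertices, it is the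
Stanley–Reisner complex of the polarization of an artinian monomial ideal over `k`. -/
def IsGeneralizedBierBall (Γ : LowerSet (Finset V)) : Prop :=
  ∃ (n : ℕ) (I : Ideal (MvPolynomial (Fin n) k)),
    IsMonomialIdeal I ∧ IsArtinianRing (MvPolynomial (Fin n) k ⧸ I) ∧
    ∃ e : V ≃ PolarizationVar I, ∀ F : Finset V,
      F ∈ Γ ↔ F.map e.toEmbedding ∈ stanleyReisnerComplex (polarization I)

end Ideals

end SimplicialTrees

/-!
The five conditions are connected through one combinatorial normal form, `IsNestedPartition`: some
of the facets partition the vertex set, and on each facet `F` of the partition the traces `F ∩ G` of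
the other facets are linearly ordered by inclusion. Equivalently (`IsColumnArrangement`), the
vertices can be arranged in columns in such a way that each column is a facet and each facet
consists of the lowest `h G i` vertices of the `i`-th column, for all `i`.

*Unmixed implies nested partition* (`IsSimplicialTree.exists_isNestedPartition`). Forests satisfy
König's theorem (`IsForest.exists_cover_card_le`), so there are as many pairwise disjoint facets as
there are vertices in a minimum cover. If all minimal covers have this size, each of them has
exactly one vertex in each of these facets and no others. Hence these facets cover `V`, and two
incomparable traces on one of them lead to a cycle of four facets, which has no leaf.

*Grafted is the same as having a nested partition* (`IsNestedPartition.isGrafted` and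
`IsGrafted.exists_isNestedPartition`): the joints of a leaf `F` of the partition are the facets with
the largest trace on `F`, and removing them one after the other sorts the traces.

*Grafted implies generalized Bier ball* (`IsColumnArrangement.isGeneralizedBierBall_ind`): the
product of the variables over a facet `G` is the polarization of the monomial with exponent `h G`,
and the columns give pure powers of the variables.

*Generalized Bier balls are vertex decomposable* (`IsGeneralizedBierBall.isVertexDecomposable`). The
facets of such a ball are the complements of the transversals `{x_{i, u i}}` for the monomials `x^u`
outside the ideal. Shedding a bottom vertex `x_{i, 0}` gives complexes of the same form for smaller
sets of exponents (`IsStaircase.isVertexDecomposable`). As a vertex decomposable complex is pure and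
the facets of `Ind Δ` are the complements of the minimal covers, `Δ` is then unmixed.

*Grafted implies Cohen–Macaulay* (`IsColumnArrangement.isCohenMacaulay`). Let `x_i` be the variable
at the bottom of the `i`-th column and let `P` be the polynomial ring in the differences of the
other variables with the bottom ones of their columns. In the coordinates `x_i` over `P` the
generators of the facet ideal are products `∏ i, ∏ j < u i, (x_i + b_{i,j})`. All products of this
form are a basis of the polynomial ring over `P`, and those divisible by a generator are a basis of
the facet ideal, so the quotient is finite and free over `P`
(`finite_and_free_quotient_span_newtonPoly`). This suffices by `isCohenMacaulay_of_finite_of_flat`.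

*Cohen–Macaulay implies unmixed* (`isUnmixed_of_isCohenMacaulay`): in the local ring at the origin,
each minimal cover gives an irreducible component, whose dimension is an upper bound for the depth
and a lower bound for the Krull dimension.
-/

namespace SimplicialTrees

/-! ### Finite flat algebras over polynomial rings are Cohen–Macaulay -/

section CohenMacaulay

open RingTheory.Sequence

/-- Every maximal ideal of `R` contains a weakly regular sequence of length `d`. -/
def HasRegularSequences (R : Type*) [CommRing R] (d : ℕ) : Prop :=
  ∀ n : Ideal R, n.IsMaximal →
    ∃ rs : List R, IsWeaklyRegular R rs ∧ (∀ r ∈ rs, r ∈ n) ∧ rs.length = d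

lemma HasRegularSequences.of_ringEquiv {R S : Type*} [CommRing R] [CommRing S] {d : ℕ}
    (h : HasRegularSequences R d) (e : R ≃+* S) : HasRegularSequences S d := by
  intro n hn
  obtain ⟨rs, h1, h2, h3⟩ := h (n.comap e) (Ideal.comap_isMaximal_of_equiv e)
  refine ⟨rs.map e, ?_, ?_, by simpa⟩
  · refine (AddEquiv.isWeaklyRegular_congr (e := e.toAddEquiv) ?_).mp h1
    rw [List.forall₂_map_right_iff, List.forall₂_same]
    intro x _ y
    simp
  · intro r hr
    obtain ⟨a, ha, rfl⟩ := List.mem_map.mp hr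
    exact h2 a ha

/-- The image of a weakly regular sequence of `R` stays weakly regular in `R[X]` by flatness; a
monic polynomial is regular modulo any ideal extended from `R`. -/
lemma HasRegularSequences.polynomial {R : Type*} [CommRing R] [IsJacobsonRing R] {d : ℕ}
    (h : HasRegularSequences R d) : HasRegularSequences (Polynomial R) (d + 1) := by
  intro n hn
  have hp : (n.comap Polynomial.C).IsMaximal :=
    Polynomial.isMaximal_comap_C_of_isJacobsonRing n
  obtain ⟨rs, h1, h2, h3⟩ := h _ hp
  -- `n` is strictly larger than the ideal extended from its contraction, so the image of `n` over
  -- the residue field is nonzero and a monic generator of it lifts to a monic element of `n`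
  obtain ⟨f, hf, hspan⟩ : ∃ f : Polynomial R, f.Monic ∧ f ∈ n := by
    have hne : n ≠ (n.comap Polynomial.C).map Polynomial.C := by
      intro heq
      have key : ∀ g ∈ n, ∀ i, g.coeff i ∈ n.comap Polynomial.C := fun g hg =>
        Ideal.mem_map_C_iff.mp (heq ▸ hg)
      have hX : (Polynomial.X : Polynomial R) ∉ n := fun hX =>
        hp.ne_top ((Ideal.eq_top_iff_one _).mpr (by simpa using key _ hX 1))
      obtain ⟨y, i, hi, hyi⟩ := hn.exists_inv hX
      refine hp.ne_top ((Ideal.eq_top_iff_one _).mpr ?_)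
      have := congrArg (fun q => Polynomial.coeff q 0) hyi
      simp only [Polynomial.coeff_add, Polynomial.coeff_mul_X_zero, zero_add,
        Polynomial.coeff_one_zero] at this
      exact this ▸ key i hi 0
    obtain ⟨f, hf, hfn⟩ := Polynomial.exists_monic_span_sup_map_eq R n hp hne
    exact ⟨f, hf, hfn ▸ Ideal.mem_sup_right (Ideal.mem_span_singleton_self f)⟩
  refine ⟨rs.map (algebraMap R (Polynomial R)) ++ [f], ?_, ?_, by simp [h3]⟩
  · rw [isWeaklyRegular_append_iff]
    refine ⟨h1.of_flat, ?_⟩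
    rw [isWeaklyRegular_singleton_iff, isSMulRegular_iff_right_eq_zero_of_smul]
    intro x hx
    obtain ⟨g, rfl⟩ := Submodule.Quotient.mk_surjective _ x
    rw [← Submodule.Quotient.mk_smul, Submodule.Quotient.mk_eq_zero] at hx
    rw [Submodule.Quotient.mk_eq_zero]
    have hI : (Ideal.ofList (rs.map (algebraMap R (Polynomial R))) • ⊤ : Ideal (Polynomial R))
        = (Ideal.ofList rs).map Polynomial.C := by
      rw [← Ideal.map_ofList, smul_eq_mul, Ideal.mul_top, Polynomial.algebraMap_eq]
    have hmem : ∀ q : Polynomial R, q ∈ (Ideal.ofList rs).map Polynomial.C ↔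
        q.map (Ideal.Quotient.mk (Ideal.ofList rs)) = 0 := by
      intro q
      rw [Ideal.mem_map_C_iff]
      simp [Polynomial.ext_iff, Ideal.Quotient.eq_zero_iff_mem]
    rw [hI, hmem] at hx ⊢
    rw [smul_eq_mul, Polynomial.map_mul] at hx
    exact (hf.map _).mul_right_eq_zero_iff.mp hx
  · intro r hr
    simp only [List.mem_append, List.mem_map, List.mem_singleton] at hr
    rcases hr with ⟨a, ha, rfl⟩ | rfl
    · exact h2 a ha
    · exact hspan

lemma hasRegularSequences_mvPolynomial (k : Type*) [Field k] (σ : Type*) [Finite σ] :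
    HasRegularSequences (MvPolynomial σ k) (Nat.card σ) := by
  induction σ using Finite.induction_empty_option with
  | of_equiv e H =>
    rw [← Nat.card_congr e]
    exact H.of_ringEquiv (MvPolynomial.renameEquiv k e).toRingEquiv
  | h_empty => exact fun n _ => ⟨[], by simp⟩
  | h_option IH =>
    rw [Finite.card_option]
    exact IH.polynomial.of_ringEquiv (MvPolynomial.optionEquivLeft k _).toRingEquiv.symm

lemma ringKrullDim_le_of_isIntegral (R S : Type*) [CommRing R] [CommRing S] [Algebra R S]
    [Algebra.IsIntegral R S] : ringKrullDim S ≤ ringKrullDim R :=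
  Order.krullDim_le_of_strictMono (PrimeSpectrum.comap (algebraMap R S))
    fun _ _ h => Ideal.IsIntegral.comap_lt_comap h

lemma length_le_localDepth {A : Type*} [CommRing A] [IsLocalRing A] {rs : List A}
    (h : IsRegular A rs) (hm : ∀ r ∈ rs, r ∈ IsLocalRing.maximalIdeal A) :
    (rs.length : ℕ∞) ≤ localDepth A :=
  le_iSup_of_le rs (le_iSup_of_le h (le_iSup_of_le hm le_rfl))

lemma localDepth_le_ringKrullDim (A : Type*) [CommRing A] [IsLocalRing A] [IsNoetherianRing A] :
    ((localDepth A : ℕ∞) : WithBot ℕ∞) ≤ ringKrullDim A := by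
  obtain ⟨d, hd⟩ : ∃ d : ℕ∞, ringKrullDim A = d :=
    ⟨_, (WithBot.coe_unbot _ (ringKrullDim_ne_bot (R := A))).symm⟩
  rw [hd, WithBot.coe_le_coe]
  refine iSup_le fun rs => iSup_le fun h => iSup_le fun _ => ?_
  have := ringKrullDim_add_length_eq_ringKrullDim_of_isRegular rs h
  have hnt : Nontrivial (A ⧸ Ideal.ofList rs) := by
    rw [Ideal.Quotient.nontrivial_iff]
    intro htop
    exact h.top_ne_smul (by rw [htop]; simp)
  have h0 := ringKrullDim_nonneg_of_nontrivial (R := A ⧸ Ideal.ofList rs)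
  rw [← WithBot.coe_le_coe, ← hd, ← this]
  calc (((rs.length : ℕ∞) : ℕ∞) : WithBot ℕ∞) = 0 + (rs.length : WithBot ℕ∞) := by simp
    _ ≤ _ := by gcongr

/-- A ring that is finite and flat over a polynomial ring over a field is Cohen–Macaulay: a
regular sequence in a maximal ideal of the polynomial ring, of length the number of variables,
remains regular in the localization above. -/
theorem isCohenMacaulay_of_finite_of_flat (k : Type*) [Field k] (σ : Type*) [Finite σ]
    (B : Type*) [CommRing B] [Algebra (MvPolynomial σ k) B] [Module.Finite (MvPolynomial σ k) B]
    [Module.Flat (MvPolynomial σ k) B] : IsCohenMacaulay B := by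
  have hB : IsNoetherianRing B := IsNoetherianRing.of_finite (MvPolynomial σ k) B
  refine ⟨hB, fun m hm => le_antisymm (localDepth_le_ringKrullDim _) ?_⟩
  have hn : (m.comap (algebraMap (MvPolynomial σ k) B)).IsMaximal :=
    Ideal.isMaximal_comap_of_isIntegral_of_isMaximal m
  obtain ⟨rs, h1, h2, h3⟩ := hasRegularSequences_mvPolynomial k σ _ hn
  have h4 : IsWeaklyRegular B (rs.map (algebraMap (MvPolynomial σ k) B)) := h1.of_flat
  have hmem : ∀ r ∈ rs.map (algebraMap (MvPolynomial σ k) B), r ∈ m := by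
    intro r hr
    obtain ⟨a, ha, rfl⟩ := List.mem_map.mp hr
    exact h2 a ha
  have h5 := h4.isRegular_of_isLocalization_of_mem (Localization.AtPrime m) m hmem
  have h6 : (Nat.card σ : ℕ∞) ≤ localDepth (Localization.AtPrime m) := by
    refine le_trans ?_ (length_le_localDepth h5 ?_)
    · simp [h3]
    · intro r hr
      obtain ⟨a, ha, rfl⟩ := List.mem_map.mp hr
      exact (IsLocalization.AtPrime.to_map_mem_maximal_iff _ m a).mpr (hmem a ha)
  calc ringKrullDim (Localization.AtPrime m) = m.height :=
        IsLocalization.AtPrime.ringKrullDim_eq_height m _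
    _ ≤ ringKrullDim B := Ideal.height_le_ringKrullDim_of_isPrime
    _ ≤ ringKrullDim (MvPolynomial σ k) := ringKrullDim_le_of_isIntegral _ _
    _ = (Nat.card σ : ℕ∞) := by
        rw [MvPolynomial.ringKrullDim_of_isNoetherianRing, ringKrullDim_eq_zero_of_field]
        simp
    _ ≤ _ := WithBot.coe_le_coe.mpr h6

end CohenMacaulay

/-! ### Depth and associated primes -/

section Depth

open RingTheory.Sequence
open scoped Pointwise

lemma ringKrullDim_quotient_add_one_le_of_lt {A : Type*} [CommRing A] {p q : Ideal A}
    [p.IsPrime] (h : p < q) : ringKrullDim (A ⧸ q) + 1 ≤ ringKrullDim (A ⧸ p) := by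
  obtain ⟨x, hxq, hxp⟩ := Set.exists_of_ssubset h
  refine ringKrullDim_succ_le_of_surjective (Ideal.Quotient.factor h.le)
    (Ideal.Quotient.factor_surjective h.le) (r := Ideal.Quotient.mk p x) ?_ ?_
  · rw [mem_nonZeroDivisors_iff_ne_zero]
    rwa [Ne, Ideal.Quotient.eq_zero_iff_mem]
  · rw [Ideal.Quotient.factor_mk, Ideal.Quotient.eq_zero_iff_mem]
    exact hxq

/-- Depth is bounded by the dimension of every associated prime: if `p` is associated to `M` and
`x` is regular on `M`, then by Nakayama some associated prime of `M / x M` contains `p` and `x`. -/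
lemma length_le_ringKrullDim_quotient_of_isAssociatedPrime {A : Type*} [CommRing A] [IsLocalRing A]
    [IsNoetherianRing A] {M : Type*} [AddCommGroup M] [Module A M] [Module.Finite A M]
    {rs : List A} (h : IsWeaklyRegular M rs) (hm : ∀ r ∈ rs, r ∈ IsLocalRing.maximalIdeal A)
    {p : Ideal A} (hp : IsAssociatedPrime p M) :
    (rs.length : WithBot ℕ∞) ≤ ringKrullDim (A ⧸ p) := by
  induction rs generalizing M p with
  | nil =>
    have := hp.isPrime
    simpa using ringKrullDim_nonneg_of_nontrivial
  | cons x rs ih =>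
    have hpp := hp.isPrime
    rw [isWeaklyRegular_cons_iff] at h
    obtain ⟨-, z, hz⟩ := isAssociatedPrime_iff.mp hp
    have hz0 : z ≠ 0 := by
      rintro rfl
      exact hpp.ne_top (by rw [hz]; simp)
    have hpz : ∀ a, a ∈ p ↔ a • z = 0 := by
      intro a
      rw [hz, Submodule.mem_colon_singleton, Submodule.mem_bot]
    have hxm : x ∈ IsLocalRing.maximalIdeal A := hm x (by simp)
    -- the submodule of elements killed by `p` is nonzero and so is not contained in `x M`
    obtain ⟨y, hy, hyx⟩ : ∃ y ∈ Submodule.torsionBySet A M p, y ∉ x • (⊤ : Submodule A M) := by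
      by_contra! hcon
      have hle : Submodule.torsionBySet A M p ≤
          (Ideal.span {x}) • Submodule.torsionBySet A M (p : Set A) := by
        intro y hy
        obtain ⟨w, -, rfl⟩ := (Submodule.mem_smul_pointwise_iff_exists _ _ _).mp (hcon y hy)
        refine Submodule.smul_mem_smul (Ideal.mem_span_singleton_self x) ?_
        rw [Submodule.mem_torsionBySet_iff] at hy ⊢
        intro a
        have := hy a
        rw [smul_comm] at this
        exact h.1.right_eq_zero_of_smul this
      have hbot := Submodule.eq_bot_of_le_smul_of_le_jacobson_bot _ _
        (IsNoetherian.noetherian _) hle (by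
          rw [IsLocalRing.jacobson_eq_maximalIdeal _ bot_ne_top, Ideal.span_singleton_le_iff_mem]
          exact hxm)
      have hzt : z ∈ Submodule.torsionBySet A M (p : Set A) := by
        rw [Submodule.mem_torsionBySet_iff]
        exact fun a => (hpz a).mp a.2
      rw [hbot] at hzt
      exact hz0 hzt
    obtain ⟨q, hq, hle⟩ := exists_le_isAssociatedPrime_of_isNoetherianRing A
      (M := QuotSMulTop x M) (Submodule.Quotient.mk y)
      (by rwa [Ne, Submodule.Quotient.mk_eq_zero])
    have hpq : p < q := by
      refine lt_of_le_of_ne (fun a ha => hle ?_) ?_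
      · rw [Submodule.mem_colon_singleton, Submodule.mem_bot, ← Submodule.Quotient.mk_smul,
          (Submodule.mem_torsionBySet_iff _ _).mp hy ⟨a, ha⟩, Submodule.Quotient.mk_zero]
      · intro heq
        have hxq : x ∈ q := hle (by
          rw [Submodule.mem_colon_singleton, Submodule.mem_bot, ← Submodule.Quotient.mk_smul,
            Submodule.Quotient.mk_eq_zero]
          exact Submodule.smul_mem_pointwise_smul _ _ _ trivial)
        rw [← heq, hpz] at hxq
        exact hz0 (h.1.right_eq_zero_of_smul hxq)
    have h1 := ih h.2 (fun r hr => hm r (List.mem_cons_of_mem _ hr)) hq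
    calc ((x :: rs).length : WithBot ℕ∞) = rs.length + 1 := by simp
      _ ≤ ringKrullDim (A ⧸ q) + 1 := by gcongr
      _ ≤ _ := ringKrullDim_quotient_add_one_le_of_lt hpq

lemma localDepth_le_ringKrullDim_quotient {A : Type*} [CommRing A] [IsLocalRing A]
    [IsNoetherianRing A] {p : Ideal A} (hp : IsAssociatedPrime p A) :
    ((localDepth A : ℕ∞) : WithBot ℕ∞) ≤ ringKrullDim (A ⧸ p) := by
  have := hp.isPrime
  rw [← WithBot.coe_unbot (ringKrullDim (A ⧸ p))
    (ne_of_gt (lt_of_lt_of_le (WithBot.bot_lt_coe _) ringKrullDim_nonneg_of_nontrivial)),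
    WithBot.coe_le_coe]
  refine iSup_le fun rs => iSup_le fun h => iSup_le fun hm => ?_
  rw [← WithBot.coe_le_coe, WithBot.coe_unbot]
  exact length_le_ringKrullDim_quotient_of_isAssociatedPrime h.1 hm hp

/-- The comparison of dimensions for a ring homomorphism that is a quotient map followed by a
localization. -/
lemma ringKrullDim_le_of_exists_isUnit_mul {S T : Type*} [CommRing S] [CommRing T] (g : S →+* T)
    (h : ∀ t, ∃ s u, IsUnit u ∧ g s = u * t) : ringKrullDim T ≤ ringKrullDim S := by
  refine Order.krullDim_le_of_strictMono (PrimeSpectrum.comap g) fun p q hpq => ?_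
  refine lt_of_le_of_ne (fun a ha => hpq.le ha) fun heq => ?_
  obtain ⟨t, htq, htp⟩ := Set.exists_of_ssubset (show p.asIdeal < q.asIdeal from hpq)
  obtain ⟨s, u, hu, hs⟩ := h t
  have hsq : s ∈ (PrimeSpectrum.comap g q).asIdeal := by
    change g s ∈ q.asIdeal
    rw [hs]
    exact Ideal.mul_mem_left _ _ htq
  rw [← heq] at hsq
  have hsp : g s ∈ p.asIdeal := hsq
  rw [hs, Ideal.unit_mul_mem_iff_mem _ hu] at hsp
  exact htp hsp

end Depth

/-! ### Cohen–Macaulay facet rings are unmixed -/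

section Unmixed

open MvPolynomial

variable {V : Type*} [Fintype V] [DecidableEq V] (k : Type*) [Field k]

/-- The endomorphism of `k[x_v : v ∈ V]` that sets the variables in `C` to zero. -/
noncomputable def killVars (C : Finset V) : MvPolynomial V k →ₐ[k] MvPolynomial V k :=
  aeval fun v => if v ∈ C then 0 else X v

variable {k}

omit [Fintype V] in
lemma killVars_X (C : Finset V) (v : V) :
    killVars k C (X v) = if v ∈ C then 0 else X v := by simp [killVars]

omit [Fintype V] in
lemma killVars_killVars {C D : Finset V} (h : C ⊆ D) (f : MvPolynomial V k) :
    killVars k D (killVars k C f) = killVars k D f := by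
  refine DFunLike.congr_fun (f := (killVars k D).comp (killVars k C)) ?_ f
  ext v : 1
  by_cases hv : v ∈ C
  · simp [killVars_X, hv, h hv]
  · simp [killVars_X, hv]

lemma killVars_univ (f : MvPolynomial V k) :
    killVars k Finset.univ f = C (constantCoeff f) := by
  have : killVars k (Finset.univ : Finset V) =
      aeval (0 : V → MvPolynomial V k) := by
    ext v : 1
    simp [killVars_X]
  rw [this, aeval_zero, MvPolynomial.algebraMap_eq]

omit [Fintype V] in
lemma facetIdeal_le_ker_killVars {Δ : LowerSet (Finset V)} {C : Finset V}
    (hC : IsVertexCover Δ C) : facetIdeal k Δ ≤ RingHom.ker (killVars k C) := by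
  rw [facetIdeal, Ideal.span_le]
  rintro _ ⟨F, hF, rfl⟩
  obtain ⟨v, hv⟩ := hC F hF
  rw [Finset.mem_inter] at hv
  rw [SetLike.mem_coe, RingHom.mem_ker, map_prod]
  exact Finset.prod_eq_zero hv.1 (by simp [killVars_X, hv.2])

/-- The prime ideal of `R / F(Δ)` generated by the variables in a vertex cover. -/
noncomputable def coverPrime {Δ : LowerSet (Finset V)} {C : Finset V} (hC : IsVertexCover Δ C) :
    Ideal (MvPolynomial V k ⧸ facetIdeal k Δ) :=
  RingHom.ker (Ideal.Quotient.lift (facetIdeal k Δ) (killVars k C).toRingHom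
    (fun _ ha => facetIdeal_le_ker_killVars hC ha))

omit [Fintype V] in
lemma mk_mem_coverPrime {Δ : LowerSet (Finset V)} {C : Finset V} (hC : IsVertexCover Δ C)
    (f : MvPolynomial V k) :
    Ideal.Quotient.mk (facetIdeal k Δ) f ∈ coverPrime hC ↔ killVars k C f = 0 :=
  Iff.rfl

instance isPrime_coverPrime {Δ : LowerSet (Finset V)} {C : Finset V} (hC : IsVertexCover Δ C) :
    (coverPrime (k := k) hC).IsPrime := RingHom.ker_isPrime _

omit [Fintype V] in
lemma IsVertexCover.mono {Δ : LowerSet (Finset V)} {C D : Finset V} (hC : IsVertexCover Δ C)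
    (h : C ⊆ D) : IsVertexCover Δ D :=
  fun F hF => (hC F hF).mono (Finset.inter_subset_inter_left h)

omit [Fintype V] in
lemma coverPrime_lt {Δ : LowerSet (Finset V)} {C D : Finset V} (hC : IsVertexCover Δ C)
    (hD : IsVertexCover Δ D) (h : C ⊂ D) : coverPrime (k := k) hC < coverPrime hD := by
  obtain ⟨v, hvD, hvC⟩ := Finset.exists_of_ssubset h
  refine lt_of_le_of_ne (fun a ha => ?_) fun heq => ?_
  · obtain ⟨f, rfl⟩ := Ideal.Quotient.mk_surjective a
    rw [mk_mem_coverPrime] at ha ⊢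
    rw [← killVars_killVars h.subset, ha, map_zero]
  · have h1 : Ideal.Quotient.mk (facetIdeal k Δ) (X v) ∈ coverPrime hD := by
      rw [mk_mem_coverPrime, killVars_X, if_pos hvD]
    rw [← heq, mk_mem_coverPrime, killVars_X, if_neg hvC] at h1
    exact X_ne_zero v h1

omit [Fintype V] in
/-- Adding the vertices of `S` to `C` one at a time gives a chain of primes. -/
lemma card_le_height_coverPrime {Δ : LowerSet (Finset V)} {C : Finset V}
    (hC : IsVertexCover Δ C) (S : Finset V) (hS : Disjoint S C) :
    (S.card : ℕ∞) ≤
      (coverPrime (k := k) (hC.mono (Finset.subset_union_right : C ⊆ S ∪ C))).height := by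
  induction S using Finset.induction_on with
  | empty => simp
  | insert v S hv ih =>
    rw [Finset.disjoint_insert_left] at hS
    rw [Finset.card_insert_of_notMem hv]
    have hlt : S ∪ C ⊂ insert v S ∪ C := by
      rw [Finset.insert_union]
      exact Finset.ssubset_insert (by simp [hv, hS.1])
    have := Ideal.height_add_one_le_of_lt_of_isPrime
      (coverPrime_lt (k := k) (hC.mono Finset.subset_union_right)
        (hC.mono Finset.subset_union_right) hlt)
    push_cast
    exact le_trans (by gcongr; exact ih hS.2) this

/-- The cover by all vertices gives the maximal ideal of the origin. -/
lemma isMaximal_coverPrime_univ {Δ : LowerSet (Finset V)}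
    (h : IsVertexCover Δ (Finset.univ : Finset V)) : (coverPrime (k := k) h).IsMaximal := by
  have hle : ∀ a ∈ facetIdeal k Δ, (constantCoeff : MvPolynomial V k →+* k) a = 0 := by
    intro a ha
    have := facetIdeal_le_ker_killVars h ha
    rw [RingHom.mem_ker, killVars_univ] at this
    exact (map_eq_zero_iff _ (C_injective V k)).mp this
  have heq : coverPrime (k := k) h = RingHom.ker (Ideal.Quotient.lift _ _ hle) := by
    ext a
    obtain ⟨f, rfl⟩ := Ideal.Quotient.mk_surjective a
    rw [mk_mem_coverPrime, RingHom.mem_ker, Ideal.Quotient.lift_mk, killVars_univ,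
      map_eq_zero_iff _ (C_injective V k)]
  rw [heq]
  exact RingHom.ker_isMaximal_of_surjective _ fun a =>
    ⟨Ideal.Quotient.mk _ (C a), by simp⟩

omit [Fintype V] in
lemma exists_facet_inter_eq_singleton {Δ : LowerSet (Finset V)} {C : Finset V}
    (hC : Minimal (IsVertexCover Δ) C) {c : V} (hc : c ∈ C) :
    ∃ F, IsFacet Δ F ∧ F ∩ C = {c} := by
  have h := hC.not_prop_of_lt (Finset.erase_ssubset hc)
  simp only [IsVertexCover, not_forall] at h
  obtain ⟨F, hF, hFC⟩ := h
  refine ⟨F, hF, ?_⟩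
  have hsub : ∀ v ∈ F ∩ C, v = c := by
    intro v hv
    by_contra hvc
    rw [Finset.mem_inter] at hv
    exact hFC ⟨v, by simp [hv.1, hv.2, hvc]⟩
  exact Finset.eq_singleton_iff_nonempty_unique_mem.mpr ⟨hC.prop F hF, hsub⟩

/-- The depth of `R / F(Δ)` at the origin is at most the dimension of each irreducible component:
the image of the product of the variables outside a minimal vertex cover `C` is a nonzero element
killed by the variables in `C`. -/
lemma localDepth_le_card_compl {Δ : LowerSet (Finset V)} {C : Finset V}
    (hC : Minimal (IsVertexCover Δ) C) (h : IsVertexCover Δ (Finset.univ : Finset V))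
    (A : Type*) [CommRing A] [IsLocalRing A] [Algebra (MvPolynomial V k ⧸ facetIdeal k Δ) A]
    [IsLocalization.AtPrime A (coverPrime (k := k) h)] :
    localDepth A ≤ ((Cᶜ).card : ℕ∞) := by
  have hA : IsNoetherianRing A :=
    IsLocalization.isNoetherianRing (coverPrime (k := k) h).primeCompl A inferInstance
  let π : MvPolynomial V k →+* A := (algebraMap _ A).comp (Ideal.Quotient.mk (facetIdeal k Δ))
  set z : A := π (∏ v ∈ Cᶜ, X v) with hz
  have hz0 : z ≠ 0 := by
    intro h0
    rw [hz, RingHom.comp_apply,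
      IsLocalization.map_eq_zero_iff (coverPrime (k := k) h).primeCompl] at h0
    obtain ⟨⟨s, hs⟩, hsz⟩ := h0
    obtain ⟨f, rfl⟩ := Ideal.Quotient.mk_surjective s
    rw [← map_mul, Ideal.Quotient.eq_zero_iff_mem] at hsz
    have h1 := facetIdeal_le_ker_killVars hC.prop hsz
    rw [RingHom.mem_ker, map_mul, mul_eq_zero, map_prod] at h1
    rcases h1 with h1 | h1
    · refine hs ((mk_mem_coverPrime h f).mpr ?_)
      rw [← killVars_killVars (Finset.subset_univ C), h1, map_zero]
    · rw [Finset.prod_eq_zero_iff] at h1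
      obtain ⟨v, hv, hv0⟩ := h1
      rw [killVars_X, if_neg (by simpa using hv)] at hv0
      exact X_ne_zero v hv0
  have hkill : ∀ c ∈ C, π (X c) * z = 0 := by
    intro c hc
    obtain ⟨F, hF, hFC⟩ := exists_facet_inter_eq_singleton hC hc
    rw [hz, ← map_mul, RingHom.comp_apply]
    have hmem : (X c * ∏ v ∈ Cᶜ, X v : MvPolynomial V k) ∈ facetIdeal k Δ := by
      rw [← Finset.prod_insert (f := fun v => (X v : MvPolynomial V k)) (by simpa using hc)]
      refine Ideal.mem_of_dvd _ (Finset.prod_dvd_prod_of_subset F _ _ fun v hv => ?_)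
        (Ideal.subset_span ⟨F, hF, rfl⟩)
      by_cases hvC : v ∈ C
      · have : v ∈ F ∩ C := Finset.mem_inter.mpr ⟨hv, hvC⟩
        rw [hFC, Finset.mem_singleton] at this
        simp [this]
      · simp [hvC]
    rw [Ideal.Quotient.eq_zero_iff_mem.mpr hmem, map_zero]
  obtain ⟨q, hq, hle⟩ := exists_le_isAssociatedPrime_of_isNoetherianRing A z hz0
  have hCq : ∀ c ∈ C, π (X c) ∈ q := fun c hc => hle (by
    rw [Submodule.mem_colon_singleton, Submodule.mem_bot]
    exact hkill c hc)
  -- `A ⧸ q` is a localization of a quotient of the polynomial ring in the variables outside `C`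
  have hdim : ringKrullDim (A ⧸ q) ≤ ringKrullDim (MvPolynomial {v // v ∈ Cᶜ} k) := by
    let ψ : MvPolynomial V k →ₐ[k] MvPolynomial {v // v ∈ Cᶜ} k :=
      aeval fun v => if hv : v ∈ Cᶜ then X ⟨v, hv⟩ else 0
    let g : MvPolynomial {v // v ∈ Cᶜ} k →+* A ⧸ q :=
      ((Ideal.Quotient.mk q).comp π).comp
        (rename (R := k) (Subtype.val : {v // v ∈ Cᶜ} → V)).toRingHom
    have hg : g.comp (ψ : MvPolynomial V k →+* _) = (Ideal.Quotient.mk q).comp π := by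
      refine MvPolynomial.ringHom_ext (fun a => ?_) (fun v => ?_)
      · simp [g, ψ, MvPolynomial.algebraMap_eq]
      · by_cases hv : v ∈ Cᶜ
        · simp only [RingHom.comp_apply, RingHom.coe_coe, ψ, aeval_X, dif_pos hv, g,
            AlgHom.toRingHom_eq_coe, rename_X]
        · simp only [RingHom.comp_apply, RingHom.coe_coe, ψ, aeval_X, dif_neg hv, map_zero]
          exact (Ideal.Quotient.eq_zero_iff_mem.mpr (hCq v (by simpa using hv))).symm
    refine ringKrullDim_le_of_exists_isUnit_mul g fun t => ?_
    obtain ⟨a, rfl⟩ := Ideal.Quotient.mk_surjective t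
    obtain ⟨⟨r, s⟩, hrs⟩ := IsLocalization.surj (coverPrime (k := k) h).primeCompl a
    obtain ⟨f, rfl⟩ := Ideal.Quotient.mk_surjective r
    refine ⟨ψ f, Ideal.Quotient.mk q (algebraMap (MvPolynomial V k ⧸ facetIdeal k Δ) A s),
      (IsLocalization.map_units A s).map _, ?_⟩
    rw [← map_mul, mul_comm, hrs]
    exact RingHom.congr_fun hg f
  have hd := (localDepth_le_ringKrullDim_quotient hq).trans hdim
  rw [MvPolynomial.ringKrullDim_of_isNoetherianRing, ringKrullDim_eq_zero_of_field, zero_add,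
    Nat.card_eq_fintype_card, Fintype.card_coe] at hd
  exact WithBot.coe_le_coe.mp hd

/-- At the origin, depth is bounded above by every component and dimension is bounded below by
every component. -/
theorem isUnmixed_of_isCohenMacaulay {Δ : LowerSet (Finset V)}
    (h : IsCohenMacaulay (MvPolynomial V k ⧸ facetIdeal k Δ)) : IsUnmixed Δ := by
  have key : ∀ C D, Minimal (IsVertexCover Δ) C → Minimal (IsVertexCover Δ) D →
      C.card ≤ D.card := by
    intro C D hC hD
    have hu : IsVertexCover Δ (Finset.univ : Finset V) := hC.prop.mono (Finset.subset_univ _)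
    have hmax := isMaximal_coverPrime_univ (k := k) hu
    have h1 := h.2 (coverPrime (k := k) hu)
    rw [IsLocalization.AtPrime.ringKrullDim_eq_height (coverPrime (k := k) hu),
      WithBot.coe_inj] at h1
    have h2 := localDepth_le_card_compl (k := k) hC hu
      (Localization.AtPrime (coverPrime (k := k) hu))
    have h3 := card_le_height_coverPrime (k := k) hD.prop Dᶜ disjoint_compl_left
    have hDu : Dᶜ ∪ D = Finset.univ := by simp [Finset.union_comm]
    simp only [hDu] at h3
    have h4 : (Dᶜ.card : ℕ∞) ≤ (Cᶜ.card : ℕ∞) := h3.trans (h1 ▸ h2)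
    have h5 : Dᶜ.card ≤ Cᶜ.card := by exact_mod_cast h4
    have := Finset.card_add_card_compl C
    have := Finset.card_add_card_compl D
    omega
  exact fun C D hC hD => le_antisymm (key C D hC hD) (key D C hD hC)

end Unmixed

/-! ### Facets and free vertices -/

section Facets

variable {V : Type*} {Δ : LowerSet (Finset V)}

lemma IsFacet.eq_of_subset {F G : Finset V} (hF : IsFacet Δ F) (hG : IsFacet Δ G) (h : F ⊆ G) :
    F = G :=
  hF.eq_of_le hG.prop h

lemma exists_isFacet_superset [Finite V] {E : Finset V} (hE : E ∈ Δ) :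
    ∃ F, IsFacet Δ F ∧ E ⊆ F := by
  obtain ⟨F, hle, hF⟩ := (Set.toFinite {E | E ∈ Δ}).exists_le_maximal hE
  exact ⟨F, hF, hle⟩

/-- A set of facets is an antichain, so it is the set of facets of the complex it generates. -/
lemma isFacet_lowerClosure_iff {S : Set (Finset V)} (hS : S ⊆ facets Δ) {F : Finset V} :
    IsFacet (lowerClosure S) F ↔ F ∈ S := by
  constructor
  · intro h
    obtain ⟨G, hG, hle⟩ := mem_lowerClosure.mp h.prop
    rwa [h.eq_of_le (subset_lowerClosure hG) hle]
  · intro h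
    refine ⟨subset_lowerClosure h, fun G hG hle => ?_⟩
    obtain ⟨G', hG', hle'⟩ := mem_lowerClosure.mp hG
    rwa [(hS h).eq_of_subset (hS hG') (hle.trans hle')]

lemma isFacet_removeFacet_iff {F G : Finset V} :
    IsFacet (removeFacet Δ G) F ↔ IsFacet Δ F ∧ F ≠ G := by
  rw [removeFacet, isFacet_lowerClosure_iff Set.sdiff_subset]
  simp [facets]

variable [DecidableEq V]

/-- A nonempty leaf contains a free vertex, i.e. one that lies in no other facet. -/
lemma IsLeaf.exists_free_vertex {F : Finset V} (h : IsLeaf Δ F) (hne : F.Nonempty) :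
    ∃ v ∈ F, ∀ H, IsFacet Δ H → v ∈ H → H = F := by
  obtain ⟨hF, h | ⟨G, -, hG, hGF, hj⟩⟩ := h
  · exact ⟨_, hne.choose_spec, fun H hH _ => h H hH⟩
  · obtain ⟨v, hvF, hvG⟩ := Finset.not_subset.mp fun hs => hGF (hF.eq_of_subset hG hs).symm
    refine ⟨v, hvF, fun H hH hvH => ?_⟩
    by_contra hne
    exact hvG (hj H hH hne (Finset.mem_inter.mpr ⟨hvF, hvH⟩))

end Facets

/-! ### Grafted complexes and nested partitions -/

section Grafted

variable {V : Type*} [DecidableEq V] {Δ : LowerSet (Finset V)}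

/-- The facets in `Fs` partition the vertex set `V`, and for each `F ∈ Fs` the traces `F ∩ G` of
the other facets form a chain. -/
structure IsNestedPartition (Δ : LowerSet (Finset V)) (Fs : Set (Finset V)) : Prop where
  isFacet : ∀ F ∈ Fs, IsFacet Δ F
  disjoint : ∀ F ∈ Fs, ∀ F' ∈ Fs, F ≠ F' → F ∩ F' = ∅
  cover : ∀ v : V, ∃ F ∈ Fs, v ∈ F
  nested : ∀ F ∈ Fs, ∀ G G', IsFacet Δ G → IsFacet Δ G' → G ≠ F → G' ≠ F →
    F ∩ G ⊆ F ∩ G' ∨ F ∩ G' ⊆ F ∩ G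

lemma IsNestedPartition.mem_iff_isLeaf [Finite V] [Nonempty V] {Fs : Set (Finset V)}
    (h : IsNestedPartition Δ Fs) (F : Finset V) : F ∈ Fs ↔ IsLeaf Δ F := by
  constructor
  · intro hF
    refine ⟨h.isFacet F hF, ?_⟩
    by_cases hone : ∀ H, IsFacet Δ H → H = F
    · exact Or.inl hone
    · right
      push Not at hone
      -- the facet with the largest trace is a joint
      obtain ⟨G, ⟨hG, hGF⟩, hmax⟩ := Set.exists_max_image {H | IsFacet Δ H ∧ H ≠ F}
        (fun H => (F ∩ H).card) (Set.toFinite _) hone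
      refine ⟨G, h.isFacet F hF, hG, hGF, fun H hH hHF => ?_⟩
      rcases h.nested F hF G H hG hH hGF hHF with h1 | h1
      · rw [← Finset.eq_of_subset_of_card_le h1 (hmax H ⟨hH, hHF⟩)]
        exact Finset.inter_subset_right
      · exact h1.trans Finset.inter_subset_right
  · intro hF
    rcases F.eq_empty_or_nonempty with rfl | hne
    · obtain ⟨F', hF', -⟩ := h.cover (Classical.arbitrary V)
      rwa [hF.1.eq_of_subset (h.isFacet F' hF') (Finset.empty_subset _)]
    · obtain ⟨v, hv, hfree⟩ := hF.exists_free_vertex hne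
      obtain ⟨F', hF', hvF'⟩ := h.cover v
      rwa [← hfree F' (h.isFacet F' hF') hvF']

theorem IsNestedPartition.isGrafted [Finite V] [Nonempty V] {Fs : Set (Finset V)}
    (h : IsNestedPartition Δ Fs) : IsGrafted Δ := by
  induction hn : (facets Δ).ncard using Nat.strong_induction_on generalizing Δ with
  | _ n ih =>
    refine IsGrafted.mk Δ Fs (facets Δ \ Fs) ?_ ?_ h.mem_iff_isLeaf ?_ h.disjoint ?_
    · exact (Set.union_sdiff_cancel h.isFacet).symm
    · exact fun G _ v _ => h.cover v
    · exact Set.sdiff_inter_self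
    · rintro G ⟨hG, hGF⟩ -
      have hf : facets (removeFacet Δ G) = facets Δ \ {G} := by
        ext F
        exact isFacet_removeFacet_iff
      refine ih _ ?_ ⟨fun F hF => ?_, h.disjoint, h.cover, ?_⟩ rfl
      · rw [hf, ← hn]
        exact Set.ncard_sdiff_singleton_lt_of_mem hG (Set.toFinite _)
      · exact isFacet_removeFacet_iff.mpr ⟨h.isFacet F hF, fun he => hGF (he ▸ hF)⟩
      · intro F hF H H' hH hH'
        exact h.nested F hF H H' (isFacet_removeFacet_iff.mp hH).1
          (isFacet_removeFacet_iff.mp hH').1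

/-- Removing the joints of a leaf one after the other orders the traces on that leaf. -/
theorem IsGrafted.exists_isNestedPartition_aux (h : IsGrafted Δ) :
    ∃ Fs : Set (Finset V), (∀ F ∈ Fs, IsFacet Δ F) ∧
      (∀ F ∈ Fs, ∀ F' ∈ Fs, F ≠ F' → F ∩ F' = ∅) ∧
      (∀ G, IsFacet Δ G → ∀ v ∈ G, ∃ F ∈ Fs, v ∈ F) ∧
      ∀ F ∈ Fs, ∀ G G', IsFacet Δ G → IsFacet Δ G' → G ≠ F → G' ≠ F →
        F ∩ G ⊆ F ∩ G' ∨ F ∩ G' ⊆ F ∩ G := by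
  induction h with
  | mk Δ Fs Gs facets_eq cover leaves disjoint pairwise_disjoint _ ih =>
    have hFs : ∀ F ∈ Fs, IsFacet Δ F := fun F hF => ((leaves F).mp hF).1
    refine ⟨Fs, hFs, pairwise_disjoint, ?_, ?_⟩
    · intro G hG v hv
      have hG' : G ∈ Fs ∪ Gs := facets_eq ▸ hG
      rcases hG' with hG' | hG'
      · exact ⟨G, hG', hv⟩
      · exact cover G hG' v hv
    · intro F hF G G' hG hG' hGF hG'F
      rcases F.eq_empty_or_nonempty with rfl | hne
      · simp
      have hleaf := (leaves F).mp hF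
      rcases hleaf.2 with hone | ⟨J, hJ⟩
      · exact absurd (hone G hG) hGF
      obtain ⟨-, hJf, hJF, hj⟩ := id hJ
      have hJ' : J ∈ Fs ∪ Gs := facets_eq ▸ hJf
      have hjoint : ∀ H, IsFacet Δ H → H ≠ F → F ∩ H ⊆ F ∩ J := fun H hH hHF =>
        Finset.subset_inter Finset.inter_subset_left (hj H hH hHF)
      rcases hJ' with hJ' | hJ'
      · left
        have := hjoint G hG hGF
        rw [pairwise_disjoint F hF J hJ' hJF.symm] at this
        exact this.trans (Finset.empty_subset _)
      · by_cases hGJ : G = J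
        · exact Or.inr (hGJ ▸ hjoint G' hG' hG'F)
        by_cases hG'J : G' = J
        · exact Or.inl (hG'J ▸ hjoint G hG hGF)
        obtain ⟨Fs', h1, -, h3, h4⟩ := ih J hJ' ⟨F, hleaf, hJ⟩
        refine h4 F ?_ G G' (isFacet_removeFacet_iff.mpr ⟨hG, hGJ⟩)
          (isFacet_removeFacet_iff.mpr ⟨hG', hG'J⟩) hGF hG'F
        -- the free vertex of `F` shows that `F` stays among the simplices after removing `J`
        obtain ⟨v, hv, hfree⟩ := hleaf.exists_free_vertex hne
        obtain ⟨F', hF', hvF'⟩ := h3 F (isFacet_removeFacet_iff.mpr ⟨hFs F hF, hJF.symm⟩) v hv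
        rwa [← hfree F' (isFacet_removeFacet_iff.mp (h1 F' hF')).1 hvF']

theorem IsGrafted.exists_isNestedPartition [Finite V] (h : IsGrafted Δ)
    (hv : ∀ v : V, {v} ∈ Δ) : ∃ Fs, IsNestedPartition Δ Fs := by
  obtain ⟨Fs, h1, h2, h3, h4⟩ := h.exists_isNestedPartition_aux
  refine ⟨Fs, h1, h2, fun v => ?_, h4⟩
  obtain ⟨G, hG, hvG⟩ := exists_isFacet_superset (hv v)
  exact h3 G hG v (by simpa using hvG)

end Grafted

/-! ### König's theorem and short cycles in forests -/

section Forest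

variable {V : Type*} [DecidableEq V]

/-- Every nonempty subfamily of the family `S` of sets has a leaf. -/
def IsForest (S : Finset (Finset V)) : Prop :=
  ∀ S' ⊆ S, S'.Nonempty → ∃ F ∈ S', (∀ H ∈ S', H = F) ∨
    ∃ G ∈ S', G ≠ F ∧ ∀ H ∈ S', H ≠ F → F ∩ H ⊆ G

lemma IsForest.mono {S S' : Finset (Finset V)} (h : IsForest S) (hs : S' ⊆ S) : IsForest S' :=
  fun S'' hs' => h S'' (hs'.trans hs)

/-- König's theorem for forests: some vertex cover is no larger than some family of pairwise
disjoint members. -/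
theorem IsForest.exists_cover_card_le (S : Finset (Finset V)) (hS : IsForest S)
    (hne : ∀ F ∈ S, F.Nonempty) :
    ∃ T ⊆ S, (∀ F ∈ T, ∀ F' ∈ T, F ≠ F' → Disjoint F F') ∧
      ∃ C : Finset V, (∀ F ∈ S, (F ∩ C).Nonempty) ∧ C.card ≤ T.card := by
  induction S using Finset.strongInduction with
  | H S ih =>
    rcases S.eq_empty_or_nonempty with rfl | hSne
    · exact ⟨∅, by simp, by simp, ∅, by simp⟩
    obtain ⟨F, hF, hone | ⟨G, hG, hGF, hj⟩⟩ := hS S subset_rfl hSne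
    · obtain ⟨x, hx⟩ := hne F hF
      refine ⟨{F}, by simpa, by simp, {x}, fun H hH => ⟨x, ?_⟩, by simp⟩
      rw [hone H hH]
      simpa
    by_cases hFG : F ∩ G = ∅
    · -- `F` is disjoint from all other members
      obtain ⟨T, hT, hd, C, hC, hcard⟩ := ih (S.erase F) (Finset.erase_ssubset hF)
        (hS.mono (Finset.erase_subset _ _)) (fun H hH => hne H (Finset.mem_of_mem_erase hH))
      obtain ⟨x, hx⟩ := hne F hF
      have hdis : ∀ H ∈ T, Disjoint F H := by
        intro H hH
        have hH' := Finset.mem_erase.mp (hT hH)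
        rw [Finset.disjoint_iff_inter_eq_empty, ← Finset.subset_empty, ← hFG]
        exact Finset.subset_inter Finset.inter_subset_left (hj H hH'.2 hH'.1)
      refine ⟨insert F T, ?_, ?_, insert x C, ?_, ?_⟩
      · exact Finset.insert_subset hF (hT.trans (Finset.erase_subset _ _))
      · intro A hA B hB hAB
        rcases Finset.mem_insert.mp hA with hA | hA <;>
          rcases Finset.mem_insert.mp hB with hB | hB
        · exact absurd (hA.trans hB.symm) hAB
        · exact hA ▸ hdis B hB
        · exact hB ▸ (hdis A hA).symm
        · exact hd A hA B hB hAB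
      · intro H hH
        by_cases hHF : H = F
        · exact ⟨x, by simp [hHF, hx]⟩
        · exact (hC H (Finset.mem_erase.mpr ⟨hHF, hH⟩)).mono
            (Finset.inter_subset_inter_left (Finset.subset_insert _ _))
      · have hFT : F ∉ T := fun h => (Finset.mem_erase.mp (hT h)).1 rfl
        rw [Finset.card_insert_of_notMem hFT]
        exact (Finset.card_insert_le _ _).trans (by omega)
    · obtain ⟨T, hT, hd, C, hC, hcard⟩ := ih (S.erase G) (Finset.erase_ssubset hG)
        (hS.mono (Finset.erase_subset _ _)) (fun H hH => hne H (Finset.mem_of_mem_erase hH))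
      refine ⟨T, hT.trans (Finset.erase_subset _ _), hd, ?_⟩
      by_cases hGC : (G ∩ C).Nonempty
      · refine ⟨C, fun H hH => ?_, hcard⟩
        by_cases hHG : H = G
        · rwa [hHG]
        · exact hC H (Finset.mem_erase.mpr ⟨hHG, hH⟩)
      · -- the vertex `c` of `C` in `F` is free, so it can be exchanged for one in `F ∩ G`
        obtain ⟨y, hy⟩ := Finset.nonempty_iff_ne_empty.mpr hFG
        obtain ⟨c, hc⟩ := hC F (Finset.mem_erase.mpr ⟨hGF.symm, hF⟩)
        rw [Finset.mem_inter] at hy hc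
        have hcG : c ∉ G := fun h => hGC ⟨c, Finset.mem_inter.mpr ⟨h, hc.2⟩⟩
        refine ⟨insert y (C.erase c), fun H hH => ?_, ?_⟩
        · by_cases hHF : H = F
          · exact ⟨y, by simp [hHF, hy.1]⟩
          by_cases hHG : H = G
          · exact ⟨y, by simp [hHG, hy.2]⟩
          obtain ⟨d, hd⟩ := hC H (Finset.mem_erase.mpr ⟨hHG, hH⟩)
          rw [Finset.mem_inter] at hd
          have hdc : d ≠ c := by
            rintro rfl
            exact hcG (hj H hH hHF (Finset.mem_inter.mpr ⟨hc.1, hd.1⟩))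
          exact ⟨d, by simp [hd.1, hd.2, hdc]⟩
        · refine (Finset.card_insert_le _ _).trans ?_
          rw [Finset.card_erase_add_one hc.2]
          exact hcard

/-- A forest contains no three members that meet pairwise in elements outside the third. -/
lemma IsForest.inter_subset_of_three {S : Finset (Finset V)} (hS : IsForest S)
    {A B C : Finset V} (hA : A ∈ S) (hB : B ∈ S) (hC : C ∈ S) (hAB : A ≠ B) (hBC : B ≠ C)
    (hAC : A ≠ C) : A ∩ B ⊆ C ∨ B ∩ C ⊆ A ∨ A ∩ C ⊆ B := by
  obtain ⟨F, hF, h⟩ := hS {A, B, C} (by simp [Finset.insert_subset_iff, hA, hB, hC]) (by simp)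
  simp only [Finset.mem_insert, Finset.mem_singleton, forall_eq_or_imp, forall_eq,
    exists_eq_or_imp, exists_eq_left] at hF h
  rcases hF with rfl | rfl | rfl
  all_goals grind

/-- A forest contains no four members that meet cyclically in elements belonging to no further
member among the four. -/
lemma IsForest.no_four_cycle {S : Finset (Finset V)} (hS : IsForest S)
    {A B C D : Finset V} (hA : A ∈ S) (hB : B ∈ S) (hC : C ∈ S) (hD : D ∈ S) {a b c d : V}
    (ha : a ∈ A ∧ a ∈ B ∧ a ∉ C ∧ a ∉ D) (hb : b ∈ B ∧ b ∈ C ∧ b ∉ D ∧ b ∉ A)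
    (hc : c ∈ C ∧ c ∈ D ∧ c ∉ A ∧ c ∉ B) (hd : d ∈ D ∧ d ∈ A ∧ d ∉ B ∧ d ∉ C) : False := by
  obtain ⟨F, hF, h⟩ := hS {A, B, C, D}
    (by simp [Finset.insert_subset_iff, hA, hB, hC, hD]) (by simp)
  simp only [Finset.mem_insert, Finset.mem_singleton, forall_eq_or_imp, forall_eq,
    exists_eq_or_imp, exists_eq_left] at hF h
  rcases hF with rfl | rfl | rfl | rfl
  all_goals grind

/-- Here `F`, `G`, `H`, `G'` would have to be a cycle of length four. -/
lemma IsForest.not_subset_union {S : Finset (Finset V)} (hS : IsForest S)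
    {F G G' H : Finset V} (hF : F ∈ S) (hG : G ∈ S) (hG' : G' ∈ S) (hH : H ∈ S) {a b : V}
    (ha : a ∈ F ∧ a ∈ G ∧ a ∉ G' ∧ a ∉ H) (hb : b ∈ F ∧ b ∈ G' ∧ b ∉ G ∧ b ∉ H)
    (hHF : ¬ H ⊆ F) (hHG : ¬ H ⊆ G) (hHG' : ¬ H ⊆ G') : ¬ ∀ w ∈ H, w ∈ G ∨ w ∈ G' := by
  intro hHGG'
  obtain ⟨x, hxH, hxF⟩ := Finset.not_subset.mp hHF
  obtain ⟨y, hyH, hyG⟩ := Finset.not_subset.mp hHG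
  obtain ⟨z, hzH, hzG'⟩ := Finset.not_subset.mp hHG'
  have hcyc := fun e d => hS.no_four_cycle hF hG hH hG' (a := a) (b := e) (c := d) (d := b)
    ⟨ha.1, ha.2.1, ha.2.2.2, ha.2.2.1⟩
  have h1 : ∀ w ∈ G, w ∈ G' → w ∈ F := by
    have := hS.inter_subset_of_three hF hG hG' (fun h => hb.2.2.1 (h ▸ hb.1))
      (fun h => ha.2.2.1 (h ▸ ha.2.1)) (fun h => ha.2.2.1 (h ▸ ha.1))
    simp only [Finset.subset_iff, Finset.mem_inter] at this
    clear hcyc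
    grind
  rcases hHGG' x hxH with hxG | hxG'
  · have h2 : ∀ w ∈ F, w ∈ H → w ∈ G := by
      have := hS.inter_subset_of_three hF hG hH (fun h => hb.2.2.1 (h ▸ hb.1))
        (fun h => ha.2.2.2 (h ▸ ha.2.1)) (fun h => ha.2.2.2 (h ▸ ha.1))
      simp only [Finset.subset_iff, Finset.mem_inter] at this
      clear hcyc
      grind
    exact hcyc x y ⟨hxG, hxH, fun h => hxF (h1 x hxG h), hxF⟩
      ⟨hyH, (hHGG' y hyH).resolve_left hyG, fun h => hyG (h2 y h hyH), hyG⟩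
      ⟨hb.2.1, hb.1, hb.2.2⟩
  · have h2 : ∀ w ∈ F, w ∈ H → w ∈ G' := by
      have := hS.inter_subset_of_three hF hG' hH (fun h => ha.2.2.1 (h ▸ ha.1))
        (fun h => hb.2.2.2 (h ▸ hb.2.1)) (fun h => ha.2.2.2 (h ▸ ha.1))
      simp only [Finset.subset_iff, Finset.mem_inter] at this
      clear hcyc
      grind
    exact hcyc z x ⟨(hHGG' z hzH).resolve_right hzG', hzH, hzG', fun h => hzG' (h2 z h hzH)⟩
      ⟨hxH, hxG', hxF, fun h => hxF (h1 x h hxG')⟩ ⟨hb.2.1, hb.1, hb.2.2⟩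

end Forest

/-! ### Unmixed simplicial trees -/

section UnmixedTree

variable {V : Type*} [Fintype V] [DecidableEq V] {Δ : LowerSet (Finset V)}

lemma exists_minimal_cover_disjoint {W : Finset V} (hW : W ∈ Ind Δ) :
    ∃ D, Minimal (IsVertexCover Δ) D ∧ Disjoint D W := by
  have hc : IsVertexCover Δ Wᶜ := by
    intro F hF
    obtain ⟨v, hvF, hvW⟩ := Finset.not_subset.mp (hW F hF)
    exact ⟨v, by simp [hvF, hvW]⟩
  obtain ⟨D, hle, hD⟩ := (Set.toFinite {D | IsVertexCover Δ D}).exists_le_minimal hc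
  exact ⟨D, hD, Finset.disjoint_of_subset_left hle disjoint_compl_left⟩

/-- Minimal vertex covers are the complements of the facets of the independence complex. -/
lemma isUnmixed_of_isPure_ind (h : IsPure (Ind Δ)) : IsUnmixed Δ := by
  have key : ∀ C, Minimal (IsVertexCover Δ) C → IsFacet (Ind Δ) Cᶜ := by
    intro C hC
    refine ⟨fun F hF hs => ?_, fun W hW hle => ?_⟩
    · obtain ⟨v, hv⟩ := hC.prop F hF
      rw [Finset.mem_inter] at hv
      exact Finset.mem_compl.mp (hs hv.1) hv.2
    · have hc : IsVertexCover Δ Wᶜ := by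
        intro F hF
        obtain ⟨v, hvF, hvW⟩ := Finset.not_subset.mp (hW F hF)
        exact ⟨v, by simp [hvF, hvW]⟩
      have := hC.le_of_le hc (compl_le_iff_compl_le.mp hle)
      exact le_compl_iff_le_compl.mp this
  intro C D hC hD
  have h1 := h _ _ (key C hC) (key D hD)
  have := Finset.card_add_card_compl C
  have := Finset.card_add_card_compl D
  omega

omit [Fintype V] in
lemma IsVertexDecomposable.isPure (h : IsVertexDecomposable Δ) : IsPure Δ := by
  cases h with
  | void => exact fun F _ hF => absurd hF.prop (by simp)
  | simplex _ h =>
    intro F G hF hG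
    rw [h.unique hF hG]
  | shed _ pure => exact pure

open Classical in
lemma IsSimplicialTree.isForest (h : IsSimplicialTree Δ) : IsForest (facets Δ).toFinset := by
  intro S hS hne
  have hS' : (S : Set (Finset V)) ⊆ facets Δ := fun F hF => by simpa using hS hF
  obtain ⟨F, hF, hleaf⟩ := h.exists_leaf S hS' (by simpa using hne)
  simp only [IsJointOf, isFacet_lowerClosure_iff hS', Finset.mem_coe] at hF hleaf
  exact ⟨F, hF, hleaf.imp id fun ⟨G, _, hG, hGF, hj⟩ => ⟨G, hG, hGF, hj⟩⟩

omit [Fintype V] in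
lemma IsSimplicialTree.facet_nonempty (h : IsSimplicialTree Δ) {F : Finset V}
    (hF : IsFacet Δ F) : F.Nonempty := by
  rw [Finset.nonempty_iff_ne_empty]
  rintro rfl
  obtain ⟨v⟩ := h.nonempty
  exact Finset.singleton_ne_empty v (hF.eq_of_le (h.vertex_mem v) (Finset.empty_subset _)).symm

open Classical in
/-- In an unmixed simplicial tree, König's theorem yields disjoint facets each of which meets every
minimal vertex cover exactly once. Two incomparable traces of `G` and `G'` on such a facet `F` would
give either a minimal vertex cover meeting `F` twice, or a facet `H` for which `F`, `G`, `H`, `G'`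
is a cycle of length four. -/
theorem IsSimplicialTree.exists_isNestedPartition (h : IsSimplicialTree Δ) (hu : IsUnmixed Δ) :
    ∃ Fs, IsNestedPartition Δ Fs := by
  have hfor := h.isForest
  have hmem : ∀ F, F ∈ (facets Δ).toFinset ↔ IsFacet Δ F := fun F =>
    Set.mem_toFinset
  obtain ⟨T, hT, hd, C, hC, hcard⟩ := hfor.exists_cover_card_le _
    (fun F hF => h.facet_nonempty ((hmem F).mp hF))
  have hTf : ∀ F ∈ T, IsFacet Δ F := fun F hF => (hmem F).mp (hT hF)
  have hCc : IsVertexCover Δ C := fun F hF => hC F ((hmem F).mpr hF)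
  obtain ⟨C₀, hle, hC₀⟩ := (Set.toFinite {D | IsVertexCover Δ D}).exists_le_minimal hCc
  have hdisj : ∀ D : Finset V, (T : Set (Finset V)).PairwiseDisjoint (fun F => F ∩ D) :=
    fun D F hF F' hF' hne => Finset.disjoint_of_subset_left Finset.inter_subset_left
      (Finset.disjoint_of_subset_right Finset.inter_subset_left (hd F hF F' hF' hne))
  have hDcard : ∀ D, Minimal (IsVertexCover Δ) D → D.card ≤ T.card := fun D hD =>
    (hu D C₀ hD hC₀).le.trans ((Finset.card_le_card hle).trans hcard)
  have hsub : ∀ D : Finset V, T.biUnion (fun F => F ∩ D) ⊆ D :=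
    fun D => Finset.biUnion_subset.mpr fun F _ => Finset.inter_subset_right
  -- a minimal cover has at most `T.card` vertices and meets each of the disjoint facets in `T`, so
  -- it has exactly one vertex in each of them and no others
  have hone : ∀ D, Minimal (IsVertexCover Δ) D → ∀ F ∈ T, (F ∩ D).card ≤ 1 := by
    intro D hD F hF
    by_contra! hlt
    have h1 : ∑ F ∈ T, 1 < ∑ F ∈ T, (F ∩ D).card :=
      Finset.sum_lt_sum (fun F hF => (hD.prop F (hTf F hF)).card_pos) ⟨F, hF, hlt⟩
    rw [← Finset.card_biUnion (hdisj D), Finset.sum_const, smul_eq_mul, mul_one] at h1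
    exact absurd ((h1.trans_le (Finset.card_le_card (hsub D))).trans_le (hDcard D hD))
      (lt_irrefl _)
  have hall : ∀ D, Minimal (IsVertexCover Δ) D → ∀ v ∈ D, ∃ F ∈ T, v ∈ F := by
    intro D hD v hv
    have h1 : T.card ≤ (T.biUnion (fun F => F ∩ D)).card := by
      rw [Finset.card_biUnion (hdisj D), Finset.card_eq_sum_ones]
      exact Finset.sum_le_sum fun F hF => (hD.prop F (hTf F hF)).card_pos
    rw [← Finset.eq_of_subset_of_card_le (hsub D) ((hDcard D hD).trans h1)] at hv
    obtain ⟨F, hF, hvF⟩ := Finset.mem_biUnion.mp hv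
    exact ⟨F, hF, (Finset.mem_inter.mp hvF).1⟩
  refine ⟨T, hTf,
    fun F hF F' hF' hne => Finset.disjoint_iff_inter_eq_empty.mp (hd F hF F' hF' hne),
    fun v => ?_, ?_⟩
  · obtain ⟨F, hF, hvF⟩ := exists_isFacet_superset (h.vertex_mem v)
    rw [Finset.singleton_subset_iff] at hvF
    -- a minimal cover that avoids the other vertices of `F` contains `v`
    have hW : F.erase v ∈ Ind Δ := by
      intro G hG hs
      have hGF := hG.eq_of_subset hF (hs.trans (Finset.erase_subset _ _))
      exact absurd (hs (hGF ▸ hvF)) (Finset.notMem_erase v F)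
    obtain ⟨D, hD, hdis⟩ := exists_minimal_cover_disjoint hW
    refine hall D hD v ?_
    obtain ⟨w, hw⟩ := hD.prop F hF
    rw [Finset.mem_inter] at hw
    by_contra hvD
    exact Finset.disjoint_left.mp hdis hw.2
      (Finset.mem_erase.mpr ⟨fun he => hvD (he ▸ hw.2), hw.1⟩)
  · intro F hF G G' hG hG' hGF hG'F
    by_contra! hcon
    obtain ⟨a, ha, ha'⟩ := Finset.not_subset.mp hcon.1
    obtain ⟨b, hb, hb'⟩ := Finset.not_subset.mp hcon.2
    rw [Finset.mem_inter] at ha hb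
    have haG' : a ∉ G' := fun hx => ha' (Finset.mem_inter.mpr ⟨ha.1, hx⟩)
    have hbG : b ∉ G := fun hx => hb' (Finset.mem_inter.mpr ⟨hb.1, hx⟩)
    have hab : a ≠ b := fun he => hbG (he ▸ ha.2)
    -- otherwise some minimal cover avoids `G ∪ G'` except for `a` and `b`, and so contains both
    obtain ⟨H, hH, hHs⟩ : ∃ H, IsFacet Δ H ∧ H ⊆ ((G ∪ G').erase a).erase b := by
      by_contra! hno
      obtain ⟨D, hD, hdis⟩ := exists_minimal_cover_disjoint (Δ := Δ) (fun H hH => hno H hH)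
      have hD' : ∀ w ∈ D, w ∈ G ∪ G' → w = a ∨ w = b := by
        intro w hw hwG
        by_contra! hne
        exact Finset.disjoint_left.mp hdis hw (by simp [hne.1, hne.2, Finset.mem_union.mp hwG])
      have haD : a ∈ D := by
        obtain ⟨w, hw⟩ := hD.prop G hG
        rw [Finset.mem_inter] at hw
        rcases hD' w hw.2 (Finset.mem_union_left _ hw.1) with rfl | rfl
        · exact hw.2
        · exact absurd hw.1 hbG
      have hbD : b ∈ D := by
        obtain ⟨w, hw⟩ := hD.prop G' hG'
        rw [Finset.mem_inter] at hw
        rcases hD' w hw.2 (Finset.mem_union_right _ hw.1) with rfl | rfl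
        · exact absurd hw.1 haG'
        · exact hw.2
      exact hab (Finset.card_le_one.mp (hone D hD F hF) a (by simp [ha.1, haD]) b
        (by simp [hb.1, hbD]))
    have haH : a ∉ H := fun hx => by simpa using hHs hx
    have hbH : b ∉ H := fun hx => by simpa using hHs hx
    have hHGG' : ∀ w ∈ H, w ∈ G ∨ w ∈ G' := fun w hw => by
      have := hHs hw
      simp only [Finset.mem_erase, Finset.mem_union] at this
      exact this.2.2
    have hFf := hTf F hF
    exact hfor.not_subset_union ((hmem F).mpr hFf) ((hmem G).mpr hG) ((hmem G').mpr hG')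
      ((hmem H).mpr hH) ⟨ha.1, ha.2, haG', haH⟩ ⟨hb.1, hb.2, hbG, hbH⟩
      (fun hs => haH (hH.eq_of_subset hFf hs ▸ ha.1))
      (fun hs => haH (hH.eq_of_subset hG hs ▸ ha.2))
      (fun hs => hbH (hH.eq_of_subset hG' hs ▸ hb.2)) hHGG'

end UnmixedTree

/-! ### Staircase complexes -/

section StaircaseComplex

variable {V : Type*} [DecidableEq V] {ι : Type*} [Fintype ι] [DecidableEq ι]

/-- The complex generated by the complements in `W` of the transversals `{c i (u i) | i}` for
`u ∈ A`. -/
def staircaseComplex (W : Finset V) (c : ι → ℕ → V) (A : Finset (ι → ℕ)) : LowerSet (Finset V) :=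
  lowerClosure ((fun u => W \ Finset.univ.image fun i => c i (u i)) '' (A : Set (ι → ℕ)))

omit [DecidableEq ι] in
lemma mem_staircaseComplex {W : Finset V} {c : ι → ℕ → V} {A : Finset (ι → ℕ)} {G : Finset V} :
    G ∈ staircaseComplex W c A ↔ ∃ u ∈ A, G ⊆ W \ Finset.univ.image fun i => c i (u i) := by
  simp [staircaseComplex, mem_lowerClosure]

/-- The vertices `c i j` that occur in the transversals given by `A` are distinct and lie in `W`,
and `A` is closed downwards. -/
structure IsStaircase (W : Finset V) (c : ι → ℕ → V) (A : Finset (ι → ℕ)) : Prop where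
  lower : ∀ u ∈ A, ∀ u' ≤ u, u' ∈ A
  mem : ∀ u ∈ A, ∀ i, c i (u i) ∈ W
  inj : ∀ u ∈ A, ∀ u' ∈ A, ∀ i i', c i (u i) = c i' (u' i') → i = i' ∧ u i = u' i'

namespace IsStaircase

variable {W : Finset V} {c : ι → ℕ → V} {A : Finset (ι → ℕ)}

omit [DecidableEq ι] in
lemma card_facet (h : IsStaircase W c A) {u : ι → ℕ} (hu : u ∈ A) :
    (W \ Finset.univ.image fun i => c i (u i)).card = W.card - Fintype.card ι := by
  rw [Finset.card_sdiff_of_subset, Finset.card_image_of_injective, Finset.card_univ]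
  · exact fun i i' hi => (h.inj u hu u hu i i' hi).1
  · intro v hv
    obtain ⟨i, -, rfl⟩ := Finset.mem_image.mp hv
    exact h.mem u hu i

omit [DecidableEq ι] in
lemma isFacet_iff (h : IsStaircase W c A) {F : Finset V} :
    IsFacet (staircaseComplex W c A) F ↔
      ∃ u ∈ A, F = W \ Finset.univ.image fun i => c i (u i) := by
  constructor
  · intro hF
    obtain ⟨u, hu, hs⟩ := mem_staircaseComplex.mp hF.prop
    exact ⟨u, hu, hF.eq_of_le (mem_staircaseComplex.mpr ⟨u, hu, subset_rfl⟩) hs⟩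
  · rintro ⟨u, hu, rfl⟩
    refine ⟨mem_staircaseComplex.mpr ⟨u, hu, subset_rfl⟩, fun G hG hle => ?_⟩
    obtain ⟨u', hu', hs⟩ := mem_staircaseComplex.mp hG
    refine (Finset.eq_of_subset_of_card_le hle ?_).ge
    exact (Finset.card_le_card hs).trans (by rw [h.card_facet hu, h.card_facet hu'])

omit [DecidableEq V] [Fintype ι] [DecidableEq ι] in
lemma filter (h : IsStaircase W c A) (i : ι) : IsStaircase W c (A.filter fun u => u i = 0) where
  lower u hu u' hle := by
    rw [Finset.mem_filter] at hu ⊢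
    exact ⟨h.lower u hu.1 u' hle, Nat.le_zero.mp ((hle i).trans hu.2.le)⟩
  mem u hu := h.mem u (Finset.mem_filter.mp hu).1
  inj u hu u' hu' := h.inj u (Finset.mem_filter.mp hu).1 u' (Finset.mem_filter.mp hu').1

omit [DecidableEq V] [Fintype ι] [DecidableEq ι] in
lemma zero_mem (h : IsStaircase W c A) {u : ι → ℕ} (hu : u ∈ A) : 0 ∈ A :=
  h.lower u hu 0 fun _ => Nat.zero_le _

/-- The facets avoiding `c i 0` are those with `u i = 0`, and every face avoiding `c i 0` lies in
one of them because `A` is closed downwards. -/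
lemma deletion_eq (h : IsStaircase W c A) (i : ι) :
    deletion (staircaseComplex W c A) {c i 0} =
      staircaseComplex W c (A.filter fun u => u i = 0) := by
  ext G
  change G ∈ staircaseComplex W c A ∧ G ∩ {c i 0} = ∅ ↔ G ∈ staircaseComplex W c _
  simp only [mem_staircaseComplex, Finset.mem_filter]
  constructor
  · rintro ⟨⟨u, hu, hs⟩, hG⟩
    refine ⟨Function.update u i 0, ⟨h.lower u hu _ ?_, by simp⟩, fun v hv => ?_⟩
    · exact update_le_iff.mpr ⟨Nat.zero_le _, fun _ _ => le_rfl⟩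
    · have h1 := hs hv
      simp only [Finset.mem_sdiff, Finset.mem_image, Finset.mem_univ, true_and, not_exists]
        at h1 ⊢
      refine ⟨h1.1, fun l hl => ?_⟩
      by_cases hli : l = i
      · subst hli
        rw [Function.update_self] at hl
        have : v ∈ G ∩ {c l 0} := by simp [hv, hl]
        simp [hG] at this
      · rw [Function.update_of_ne hli] at hl
        exact h1.2 l hl
  · rintro ⟨u, ⟨hu, hui⟩, hs⟩
    refine ⟨⟨u, hu, hs⟩, ?_⟩
    rw [Finset.inter_singleton_of_notMem]
    intro hv
    have := hs hv
    simp only [Finset.mem_sdiff, Finset.mem_image, Finset.mem_univ, true_and, not_exists] at this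
    exact this.2 i (by rw [hui])

/-- The exponents `u` with `u + e_i ∈ A`. -/
def shift (A : Finset (ι → ℕ)) (i : ι) : Finset (ι → ℕ) :=
  (A.image fun u => u - Pi.single i 1).filter fun u => u + Pi.single i 1 ∈ A

lemma mem_shift {i : ι} {u : ι → ℕ} : u ∈ shift A i ↔ u + Pi.single i 1 ∈ A := by
  rw [shift, Finset.mem_filter, and_iff_right_iff_imp]
  exact fun h => Finset.mem_image.mpr ⟨_, h, add_tsub_cancel_right _ _⟩

lemma shift_isStaircase (h : IsStaircase W c A) (i : ι) :
    IsStaircase (W.erase (c i 0)) (fun l j => c l (j + (Pi.single i 1 : ι → ℕ) l)) (shift A i) where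
  lower u hu u' hle := by
    rw [mem_shift] at hu ⊢
    exact h.lower _ hu _ (add_le_add_left hle _)
  mem u hu l := by
    rw [mem_shift] at hu
    refine Finset.mem_erase.mpr ⟨fun heq => ?_, h.mem _ hu l⟩
    obtain ⟨rfl, h2⟩ := h.inj _ hu 0 (h.zero_mem hu) l i heq
    simp at h2
  inj u hu u' hu' l l' heq := by
    rw [mem_shift] at hu hu'
    obtain ⟨rfl, h2⟩ := h.inj _ hu _ hu' l l' heq
    exact ⟨rfl, add_right_cancel h2⟩

lemma link_eq (h : IsStaircase W c A) (i : ι) :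
    link (staircaseComplex W c A) {c i 0} =
      staircaseComplex (W.erase (c i 0)) (fun l j => c l (j + (Pi.single i 1 : ι → ℕ) l))
        (shift A i) := by
  ext G
  change G ∈ staircaseComplex W c A ∧ G ∪ {c i 0} ∈ staircaseComplex W c A ∧ G ∩ {c i 0} = ∅ ↔
    G ∈ staircaseComplex _ _ _
  simp only [mem_staircaseComplex, mem_shift]
  constructor
  · rintro ⟨-, ⟨u, hu, hs⟩, hG⟩
    have hv := hs (Finset.mem_union_right _ (Finset.mem_singleton_self _))
    have hui : u i ≠ 0 := by
      intro h0
      simp only [Finset.mem_sdiff, Finset.mem_image, Finset.mem_univ, true_and, not_exists] at hv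
      exact hv.2 i (by rw [h0])
    have hadd : u - Pi.single i 1 + Pi.single i 1 = u := by
      refine tsub_add_cancel_of_le fun l => ?_
      by_cases hl : l = i
      · subst hl
        simpa using Nat.one_le_iff_ne_zero.mpr hui
      · simp [hl]
    refine ⟨u - Pi.single i 1, by rwa [hadd], fun w hw => ?_⟩
    have h1 := hs (Finset.mem_union_left _ hw)
    simp only [← Pi.add_apply, hadd]
    rw [Finset.mem_sdiff] at h1 ⊢
    refine ⟨Finset.mem_erase.mpr ⟨?_, h1.1⟩, h1.2⟩
    rintro rfl
    have : c i 0 ∈ G ∩ {c i 0} := by simp [hw]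
    simp [hG] at this
  · rintro ⟨u, hu, hs⟩
    have hsub : G ∪ {c i 0} ⊆
        W \ Finset.univ.image fun l => c l ((u + Pi.single i 1 : ι → ℕ) l) := by
      refine Finset.union_subset (hs.trans ?_) ?_
      · exact Finset.sdiff_subset_sdiff (Finset.erase_subset _ _) subset_rfl
      · rw [Finset.singleton_subset_iff, Finset.mem_sdiff]
        refine ⟨h.mem 0 (h.zero_mem hu) i, fun hv => ?_⟩
        obtain ⟨l, -, hl⟩ := Finset.mem_image.mp hv
        obtain ⟨rfl, h2⟩ := h.inj _ hu 0 (h.zero_mem hu) l i hl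
        simp at h2
    refine ⟨⟨_, hu, Finset.subset_union_left.trans hsub⟩, ⟨_, hu, hsub⟩, ?_⟩
    rw [Finset.inter_singleton_of_notMem]
    intro hv
    simpa using hs hv

/-- The vertex `c i 0` is a shedding vertex for every index `i` such that some `u ∈ A` has
`u i ≠ 0`: its link and its deletion are staircase complexes of smaller sets of exponents. -/
theorem isVertexDecomposable (h : IsStaircase W c A) :
    IsVertexDecomposable (staircaseComplex W c A) := by
  induction hn : A.card using Nat.strong_induction_on generalizing W c A with
  | _ n ih =>
    by_cases h0 : ∃ u ∈ A, ∃ i, u i ≠ 0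
    · obtain ⟨u, hu, i, hui⟩ := h0
      refine .shed _ ?_ (c i 0) ?_ ?_ ?_
      · intro F G hF hG
        obtain ⟨u, hu, rfl⟩ := h.isFacet_iff.mp hF
        obtain ⟨u', hu', rfl⟩ := h.isFacet_iff.mp hG
        rw [h.card_facet hu, h.card_facet hu']
      · intro F hF
        rw [h.deletion_eq, (h.filter i).isFacet_iff] at hF
        obtain ⟨u, hu, rfl⟩ := hF
        exact h.isFacet_iff.mpr ⟨u, (Finset.mem_filter.mp hu).1, rfl⟩
      · rw [h.link_eq]
        refine ih _ ?_ (h.shift_isStaircase i) rfl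
        rw [← hn]
        refine lt_of_le_of_lt (b := (A.erase 0).card) ?_
          (Finset.card_erase_lt_of_mem (h.zero_mem hu))
        refine Finset.card_le_card_of_injOn (fun u => u + Pi.single i 1) (fun u hu => ?_)
          (fun _ _ _ _ heq => add_right_cancel heq)
        refine Finset.mem_coe.mpr (Finset.mem_erase.mpr ⟨fun heq => ?_, mem_shift.mp hu⟩)
        simpa using congrFun heq i
      · rw [h.deletion_eq]
        refine ih _ ?_ (h.filter i) rfl
        rw [← hn]
        exact Finset.card_lt_card (Finset.filter_ssubset.mpr ⟨u, hu, hui⟩)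
    · push Not at h0
      rcases A.eq_empty_or_nonempty with rfl | ⟨u, hu⟩
      · have : staircaseComplex W c ∅ = ⊥ := by
          ext G
          simp [staircaseComplex]
        rw [this]
        exact .void
      · refine .simplex _ ⟨_, h.isFacet_iff.mpr ⟨u, hu, rfl⟩, fun F hF => ?_⟩
        obtain ⟨u', hu', rfl⟩ := h.isFacet_iff.mp hF
        rw [show u' = u from funext fun i => (h0 u' hu' i).trans (h0 u hu i).symm]

end IsStaircase

end StaircaseComplex

/-! ### Graphs that are trees -/

section GraphTree

variable {V : Type*} [Fintype V] [DecidableEq V]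

omit [Fintype V] in
lemma mem_graphComplex {G : SimpleGraph V} {F : Finset V} :
    F ∈ graphComplex G ↔ F.card ≤ 1 ∨ ∃ u v, G.Adj u v ∧ F = {u, v} := Iff.rfl

omit [Fintype V] in
lemma isFacet_graphComplex_pair {G : SimpleGraph V} {u v : V} (h : G.Adj u v) :
    IsFacet (graphComplex G) {u, v} := by
  refine ⟨mem_graphComplex.mpr (Or.inr ⟨u, v, h, rfl⟩), fun F hF hle => ?_⟩
  refine (Finset.eq_of_subset_of_card_le hle ?_).ge
  rw [Finset.card_pair h.ne]
  rcases hF with hF | ⟨a, b, -, rfl⟩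
  · omega
  · exact Finset.card_le_two

omit [Fintype V] in
/-- In a connected graph with at least two vertices the facets are the edges. -/
lemma exists_adj_of_isFacet_graphComplex [Nontrivial V] {G : SimpleGraph V} (hG : G.Connected)
    {F : Finset V} (hF : IsFacet (graphComplex G) F) : ∃ u v, G.Adj u v ∧ F = {u, v} := by
  rcases hF.prop with h | h
  · obtain ⟨u, hu⟩ := Finset.card_le_one_iff_subset_singleton.mp h
    obtain ⟨v, huv⟩ := hG.preconnected.exists_adj_of_nontrivial u
    refine ⟨u, v, huv, hF.eq_of_le (isFacet_graphComplex_pair huv).prop (hu.trans ?_)⟩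
    simp
  · exact h

omit [Fintype V] in
lemma isConnected_graphComplex [Nontrivial V] {G : SimpleGraph V} (hG : G.Connected) :
    IsConnected (graphComplex G) := by
  have key : ∀ a b, G.Reachable a b → ∀ E F, IsFacet (graphComplex G) E →
      IsFacet (graphComplex G) F → a ∈ E → b ∈ F →
      Relation.ReflTransGen (fun A B => IsFacet (graphComplex G) A ∧ IsFacet (graphComplex G) B ∧
        (A ∩ B).Nonempty) E F := by
    rintro a b ⟨p⟩
    induction p with
    | nil => exact fun E F hE hF ha hb => .single ⟨hE, hF, _, Finset.mem_inter.mpr ⟨ha, hb⟩⟩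
    | cons hadj _ ih =>
      intro E F hE hF ha hb
      have hf := isFacet_graphComplex_pair hadj
      exact .head ⟨hE, hf, _, Finset.mem_inter.mpr ⟨ha, by simp⟩⟩
        (ih _ F hf hF (by simp) hb)
  intro E F hE hF
  obtain ⟨a, a', -, rfl⟩ := exists_adj_of_isFacet_graphComplex hG hE
  obtain ⟨b, b', -, rfl⟩ := exists_adj_of_isFacet_graphComplex hG hF
  exact key a b (hG.preconnected a b) _ _ hE hF (by simp) (by simp)

omit [Fintype V] [DecidableEq V] in
/-- In a tree with root `r` every vertex has at most one neighbour closer to the root. -/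
lemma _root_.SimpleGraph.IsTree.eq_of_adj_of_dist_eq {G : SimpleGraph V} (hG : G.IsTree) (r : V)
    {v u w : V} (hu : G.Adj v u) (hw : G.Adj v w) (hdu : G.dist r v = G.dist r u + 1)
    (hdw : G.dist r v = G.dist r w + 1) : u = w := by
  obtain ⟨p, hp, hpl⟩ := (hG.connected r u).exists_path_of_dist
  obtain ⟨q, hq, hql⟩ := (hG.connected r w).exists_path_of_dist
  have hlast : ∀ {x : V} (p : G.Walk r x) (_ : p.length = G.dist r x)
      (_ : G.dist r v = G.dist r x + 1), v ∉ p.support := by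
    classical
    intro x p hpl hd hv
    have h1 := SimpleGraph.dist_le (p.takeUntil v hv)
    have h2 := p.length_takeUntil_le_length hv
    omega
  have h1 := hp.concat (hlast p hpl hdu) hu.symm
  have h2 := hq.concat (hlast q hql hdw) hw.symm
  have := congrArg Subtype.val (hG.isAcyclic.subsingleton_path r v |>.elim ⟨_, h1⟩ ⟨_, h2⟩)
  have h3 := congrArg SimpleGraph.Walk.penultimate this
  simpa using h3

/-- A set of edges of a tree has a leaf, namely an edge reaching farthest from a root. -/
theorem isSimplicialTree_graphComplex {G : SimpleGraph V} (hG : G.IsTree) :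
    IsSimplicialTree (graphComplex G) := by
  have hne := hG.connected.nonempty
  have hvert : ∀ v : V, {v} ∈ graphComplex G := fun v => Or.inl (by simp)
  rcases subsingleton_or_nontrivial V with hsub | hnt
  · have huniv : ∀ F, IsFacet (graphComplex G) F → F = Finset.univ := by
      intro F hF
      refine hF.eq_of_le (Or.inl ?_) (Finset.subset_univ _)
      exact Finset.card_le_one.mpr fun a _ b _ => Subsingleton.elim a b
    refine ⟨hne, hvert, fun E F hE hF => ?_, fun S hS ⟨F, hF⟩ => ⟨F, ?_⟩⟩
    · rw [huniv E hE, huniv F hF]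
    · refine ⟨(isFacet_lowerClosure_iff hS).mpr hF, Or.inl fun H hH => ?_⟩
      rw [huniv F (hS hF), huniv H (hS ((isFacet_lowerClosure_iff hS).mp hH))]
  refine ⟨hne, hvert, isConnected_graphComplex hG.connected, fun S hS hSne => ?_⟩
  obtain ⟨r⟩ := hne
  -- an edge with an endpoint at maximal distance from `r`
  obtain ⟨F₀, hF₀⟩ := hSne
  have hpair : ∀ F ∈ S, ∃ u v, G.Adj u v ∧ F = {u, v} :=
    fun F hF => exists_adj_of_isFacet_graphComplex hG.connected (hS hF)
  obtain ⟨v, ⟨F, hF, hvF⟩, hmax⟩ := Set.exists_max_image {v | ∃ F ∈ S, v ∈ F} (G.dist r)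
    (Set.toFinite _) (by
      obtain ⟨u, v, -, rfl⟩ := hpair F₀ hF₀
      exact ⟨u, _, hF₀, by simp⟩)
  have hnbr : ∀ H ∈ S, v ∈ H → ∃ w, G.Adj v w ∧ H = {v, w} ∧ G.dist r v = G.dist r w + 1 := by
    intro H hH hvH
    obtain ⟨w, hvw, hHw⟩ : ∃ w, G.Adj v w ∧ H = {v, w} := by
      obtain ⟨a, b, hab, rfl⟩ := hpair H hH
      simp only [Finset.mem_insert, Finset.mem_singleton] at hvH
      rcases hvH with rfl | rfl
      · exact ⟨b, hab, rfl⟩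
      · exact ⟨a, hab.symm, Finset.pair_comm _ _⟩
    refine ⟨w, hvw, hHw, (hG.dist_eq_dist_add_one_of_adj r hvw).resolve_right fun h => ?_⟩
    have := hmax w ⟨H, hH, by simp [hHw]⟩
    omega
  obtain ⟨u, hvu, rfl, hdu⟩ := hnbr F hF hvF
  have hfree : ∀ H ∈ S, v ∈ H → H = {v, u} := by
    intro H hH hvH
    obtain ⟨w, hvw, rfl, hdw⟩ := hnbr H hH hvH
    rw [hG.eq_of_adj_of_dist_eq r hvu hvw hdu hdw]
  refine ⟨{v, u}, (isFacet_lowerClosure_iff hS).mpr hF, ?_⟩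
  by_cases hone : ∀ H ∈ S, H = {v, u}
  · exact Or.inl fun H hH => hone H ((isFacet_lowerClosure_iff hS).mp hH)
  right
  push Not at hone
  have hinter : ∀ H ∈ S, H ≠ {v, u} → ∀ x ∈ ({v, u} ∩ H : Finset V), x = u ∧ u ∈ H := by
    intro H hH hHF x hx
    simp only [Finset.mem_inter, Finset.mem_insert, Finset.mem_singleton] at hx
    rcases hx.1 with rfl | rfl
    · exact absurd (hfree H hH hx.2) hHF
    · exact ⟨rfl, hx.2⟩
  by_cases hu : ∃ J ∈ S, J ≠ {v, u} ∧ u ∈ J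
  · obtain ⟨J, hJ, hJF, huJ⟩ := hu
    refine ⟨J, (isFacet_lowerClosure_iff hS).mpr hF, (isFacet_lowerClosure_iff hS).mpr hJ, hJF,
      fun H hH hHF x hx => ?_⟩
    rw [(hinter H ((isFacet_lowerClosure_iff hS).mp hH) hHF x hx).1]
    exact huJ
  · obtain ⟨J, hJ, hJF⟩ := hone
    refine ⟨J, (isFacet_lowerClosure_iff hS).mpr hF, (isFacet_lowerClosure_iff hS).mpr hJ, hJF,
      fun H hH hHF x hx => ?_⟩
    have hH' := (isFacet_lowerClosure_iff hS).mp hH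
    exact absurd ⟨H, hH', hHF, (hinter H hH' hHF x hx).2⟩ hu

end GraphTree

/-! ### Multivariate Newton polynomials -/

section NewtonBasis

open MvPolynomial

variable {ι P : Type*} [Fintype ι] [DecidableEq ι] [LinearOrder ι] [CommRing P]

/-- The product `∏ i, ∏ j < u i, (x_i + b_{i,j})`, a multivariate Newton polynomial with leading
monomial `x^u`. -/
noncomputable def newtonPoly (b : ι → ℕ → P) (u : ι → ℕ) : MvPolynomial ι P :=
  ∏ i, ∏ j ∈ Finset.range (u i), (X i + C (b i j))

omit [LinearOrder ι] in
lemma newtonPoly_add_single (b : ι → ℕ → P) (u : ι → ℕ) (i : ι) :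
    newtonPoly b (u + Pi.single i 1) = (X i + C (b i (u i))) * newtonPoly b u := by
  rw [newtonPoly, newtonPoly, ← Finset.mul_prod_erase _ _ (Finset.mem_univ i),
    ← Finset.mul_prod_erase _ (fun i => ∏ j ∈ Finset.range (u i), _) (Finset.mem_univ i),
    ← mul_assoc]
  congr 1
  · rw [Pi.add_apply, Pi.single_eq_same, Finset.prod_range_succ, mul_comm]
  · refine Finset.prod_congr rfl fun l hl => ?_
    rw [Pi.add_apply, Pi.single_eq_of_ne (Finset.ne_of_mem_erase hl), add_zero]

omit [DecidableEq ι] [LinearOrder ι] in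
lemma newtonPoly_zero (b : ι → ℕ → P) : newtonPoly b 0 = 1 := by
  simp [newtonPoly]

omit [DecidableEq ι] [LinearOrder ι] in
lemma newtonPoly_dvd (b : ι → ℕ → P) {u u' : ι → ℕ} (h : u ≤ u') :
    newtonPoly b u ∣ newtonPoly b u' :=
  Finset.prod_dvd_prod_of_dvd _ _ fun i _ =>
    Finset.prod_dvd_prod_of_subset _ _ _ (Finset.range_subset_range.mpr (h i))

omit [Fintype ι] [DecidableEq ι] [LinearOrder ι] in
lemma mul_mem_of_X_mul_mem {N : Submodule P (MvPolynomial ι P)}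
    (h : ∀ i, ∀ x ∈ N, X i * x ∈ N) (p : MvPolynomial ι P) {x : MvPolynomial ι P} (hx : x ∈ N) :
    p * x ∈ N := by
  induction p using MvPolynomial.induction_on with
  | C a => rw [C_mul']; exact N.smul_mem a hx
  | add p q hp hq => rw [add_mul]; exact N.add_mem hp hq
  | mul_X p i hp => rw [mul_comm p, mul_assoc]; exact h i _ hp

omit [LinearOrder ι] in
lemma X_mul_mem_span_newtonPoly (b : ι → ℕ → P) {U : Set (ι → ℕ)} (hU : IsUpperSet U) (i : ι)
    (x : MvPolynomial ι P) (hx : x ∈ Submodule.span P (newtonPoly b '' U)) :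
    X i * x ∈ Submodule.span P (newtonPoly b '' U) := by
  induction hx using Submodule.span_induction with
  | mem x hx =>
    obtain ⟨u, hu, rfl⟩ := hx
    have heq : X i * newtonPoly b u =
        newtonPoly b (u + Pi.single i 1) - b i (u i) • newtonPoly b u := by
      rw [newtonPoly_add_single, ← C_mul']
      ring
    rw [heq]
    refine Submodule.sub_mem _ (Submodule.subset_span ⟨_, hU ?_ hu, rfl⟩)
      (Submodule.smul_mem _ _ (Submodule.subset_span ⟨u, hu, rfl⟩))
    exact le_self_add
  | zero => simp
  | add x y _ _ hx hy => rw [mul_add]; exact Submodule.add_mem _ hx hy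
  | smul a x _ hx => rw [mul_smul_comm]; exact Submodule.smul_mem _ _ hx

omit [LinearOrder ι] in
lemma span_range_newtonPoly (b : ι → ℕ → P) :
    Submodule.span P (Set.range (newtonPoly b)) = ⊤ := by
  refine eq_top_iff.mpr fun p _ => ?_
  have := mul_mem_of_X_mul_mem (X_mul_mem_span_newtonPoly b isUpperSet_univ) p
    (Submodule.subset_span ⟨0, Set.mem_univ _, newtonPoly_zero b⟩)
  rwa [mul_one, Set.image_univ] at this

omit [LinearOrder ι] in
/-- The ideal generated by the Newton polynomials over an upper set is their span. -/
lemma restrictScalars_span_newtonPoly (b : ι → ℕ → P) {U : Set (ι → ℕ)} (hU : IsUpperSet U) :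
    (Ideal.span (newtonPoly b '' U)).restrictScalars P =
      Submodule.span P (newtonPoly b '' U) := by
  refine le_antisymm (fun x hx => ?_)
    (Submodule.span_le.mpr fun x hx => Ideal.subset_span hx)
  rw [Submodule.restrictScalars_mem] at hx
  induction hx using Submodule.span_induction with
  | mem x hx => exact Submodule.subset_span hx
  | zero => exact Submodule.zero_mem _
  | add x y _ _ hx hy => exact Submodule.add_mem _ hx hy
  | smul a x _ hx => exact mul_mem_of_X_mul_mem (X_mul_mem_span_newtonPoly b hU) a hx

omit [DecidableEq ι] in
/-- Newton polynomials are monic with distinct leading monomials. -/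
lemma linearIndependent_newtonPoly [Nontrivial P] (b : ι → ℕ → P) :
    LinearIndependent P (newtonPoly b) := by
  have hmonic : ∀ u, MonomialOrder.lex.Monic (newtonPoly b u) := fun u =>
    .prod fun i _ => .prod fun j _ => MonomialOrder.monic_X_add_C _ _ _
  have hdeg : ∀ u, MonomialOrder.lex.degree (newtonPoly b u) = Finsupp.equivFunOnFinite.symm u := by
    intro u
    rw [newtonPoly, MonomialOrder.degree_prod_of_regular]
    · have h1 : ∀ i, MonomialOrder.lex.degree
          (∏ j ∈ Finset.range (u i), (X i + C (b i j)) : MvPolynomial ι P) =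
          Finsupp.single i (u i) := by
        intro i
        rw [MonomialOrder.degree_prod_of_regular]
        · simp [MonomialOrder.degree_X_add_C]
        · intro j _
          rw [(MonomialOrder.monic_X_add_C _ _ _).leadingCoeff_eq_one]
          exact isRegular_one
      simp only [h1]
      ext i
      simp [Finsupp.finsetSum_apply, Finsupp.single_apply]
    · intro i _
      rw [MonomialOrder.Monic.leadingCoeff_eq_one
        (.prod fun j _ => MonomialOrder.monic_X_add_C _ _ _)]
      exact isRegular_one
  rw [linearIndependent_iff']
  intro s g hg
  by_contra! hcon
  obtain ⟨u, ⟨hus, hu0⟩, hmax⟩ := Set.Finite.exists_maximalFor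
    (fun u => MonomialOrder.lex.toSyn (Finsupp.equivFunOnFinite.symm u : ι →₀ ℕ))
    {u | u ∈ s ∧ g u ≠ 0} (s.finite_toSet.subset fun u hu => hu.1) hcon
  have h1 := congrArg (coeff (Finsupp.equivFunOnFinite.symm u)) hg
  rw [coeff_sum, Finset.sum_eq_single u] at h1
  · rw [coeff_smul, ← hdeg u, (hmonic u).coeff_degree, smul_eq_mul, mul_one, coeff_zero] at h1
    exact hu0 h1
  · intro u' hu's hne
    by_cases h0 : g u' = 0
    · simp [h0]
    rw [coeff_smul, MonomialOrder.coeff_eq_zero_of_lt (m := MonomialOrder.lex), smul_zero]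
    rw [hdeg]
    refine lt_of_le_of_ne ?_ fun heq => hne ?_
    · rcases le_total (MonomialOrder.lex.toSyn (Finsupp.equivFunOnFinite.symm u' : ι →₀ ℕ))
        (MonomialOrder.lex.toSyn (Finsupp.equivFunOnFinite.symm u)) with h | h
      · exact h
      · exact hmax ⟨hu's, h0⟩ h
    · exact Finsupp.equivFunOnFinite.symm.injective (MonomialOrder.lex.toSyn.injective heq)
  · exact fun h => absurd hus h

/-- The Newton polynomials outside an upper set `U` form a basis modulo those in `U`. -/
theorem finite_and_free_quotient_span_newtonPoly [Nontrivial P] (b : ι → ℕ → P)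
    {U : Set (ι → ℕ)} (hU : IsUpperSet U) (hfin : Uᶜ.Finite) :
    Module.Finite P (MvPolynomial ι P ⧸ Ideal.span (newtonPoly b '' U)) ∧
      Module.Free P (MvPolynomial ι P ⧸ Ideal.span (newtonPoly b '' U)) := by
  have hli := linearIndependent_newtonPoly b
  have hcompl : IsCompl ((Ideal.span (newtonPoly b '' U)).restrictScalars P)
      (Submodule.span P (newtonPoly b '' Uᶜ)) := by
    rw [restrictScalars_span_newtonPoly b hU]
    refine ⟨hli.disjoint_span_image disjoint_compl_right, ?_⟩
    rw [codisjoint_iff, ← Submodule.span_union, ← Set.image_union, Set.union_compl_self,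
      Set.image_univ, span_range_newtonPoly]
  let e : (MvPolynomial ι P ⧸ Ideal.span (newtonPoly b '' U)) ≃ₗ[P]
      Submodule.span P (newtonPoly b '' Uᶜ) :=
    (Submodule.Quotient.restrictScalarsEquiv P _).symm.trans
      (Submodule.quotientEquivOfIsCompl _ _ hcompl)
  have hfree : Module.Free P (Submodule.span P (newtonPoly b '' Uᶜ)) := by
    have h1 := hli.comp (Subtype.val : (Uᶜ : Set _) → ι → ℕ) Subtype.val_injective
    have h2 := Module.Free.of_basis (Module.Basis.span h1)
    rwa [Set.range_comp, Subtype.range_val] at h2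
  have hfinite : Module.Finite P (Submodule.span P (newtonPoly b '' Uᶜ)) :=
    Module.Finite.span_of_finite P (hfin.image _)
  exact ⟨Module.Finite.equiv e.symm, Module.Free.of_equiv e.symm⟩

end NewtonBasis

/-! ### Arrangement of the vertices in columns -/

section Coordinates

variable {V : Type*} [DecidableEq V] {Δ : LowerSet (Finset V)} {n : ℕ}

/-- The vertices are arranged by `pos` in `n` columns, the `i`-th one occupying the places
`(i, 0), …, (i, m i - 1)`. Each column is a facet, and each facet `G` consists of the `h G i` lowest
vertices of the `i`-th column, for all `i`. -/
structure IsColumnArrangement (Δ : LowerSet (Finset V)) (pos : V → Fin n × ℕ) (m : Fin n → ℕ)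
    (h : Finset V → Fin n → ℕ) : Prop where
  injective : Function.Injective pos
  exists_pos_eq : ∀ i j, j < m i → ∃ v, pos v = (i, j)
  height_le : ∀ G i, h G i ≤ m i
  mem_iff : ∀ G, IsFacet Δ G → ∀ v, v ∈ G ↔ (pos v).2 < h G (pos v).1
  exists_column : ∀ i, ∃ F, IsFacet Δ F ∧ ∀ v, v ∈ F ↔ (pos v).1 = i

/-- The vertices of each simplex of a nested partition are ordered by the number of facets that
avoid them. -/
theorem IsNestedPartition.exists_isColumnArrangement [Fintype V] {Fs : Set (Finset V)}
    (hFs : IsNestedPartition Δ Fs) :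
    ∃ (n : ℕ) (pos : V → Fin n × ℕ) (m : Fin n → ℕ) (h : Finset V → Fin n → ℕ),
      IsColumnArrangement Δ pos m h := by
  classical
  obtain ⟨n, ⟨ε⟩⟩ := Finite.exists_equiv_fin Fs
  choose S hS hvS using hFs.cover
  have hSeq : ∀ F (hF : F ∈ Fs) v, v ∈ F → S v = F := by
    intro F hF v hv
    by_contra hne
    have := hFs.disjoint _ (hS v) F hF hne
    exact absurd (this ▸ Finset.mem_inter.mpr ⟨hvS v, hv⟩) (Finset.notMem_empty v)
  let col : V → Fin n := fun v => ε ⟨S v, hS v⟩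
  have hcol : ∀ v i, v ∈ (ε.symm i).1 ↔ col v = i := by
    intro v i
    constructor
    · intro hv
      exact (ε.eq_symm_apply).mp (Subtype.ext (hSeq _ (ε.symm i).2 v hv))
    · rintro rfl
      simpa [col] using hvS v
  -- a linear order refining the number of facets that avoid a vertex
  let f : V → ℕ := fun v => {H | IsFacet Δ H ∧ v ∉ H}.ncard
  obtain ⟨e, he⟩ : ∃ e : V ≃ Fin (Fintype.card V), ∀ v w, e v ≤ e w → f v ≤ f w := by
    let e₀ := Fintype.equivFin V
    refine ⟨e₀.trans (Tuple.sort (f ∘ e₀.symm)).symm, fun v w hvw => ?_⟩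
    simpa using Tuple.monotone_sort (f ∘ e₀.symm) hvw
  have hdown : ∀ G, IsFacet Δ G → ∀ v w, v ∈ G → col w = col v → e w ≤ e v → w ∈ G := by
    intro G hG v w hv hcw hle
    by_contra hw
    have hvF : v ∈ (ε.symm (col v)).1 := (hcol v _).mpr rfl
    have hwF : w ∈ (ε.symm (col v)).1 := (hcol w _).mpr hcw
    have hF := (ε.symm (col v)).2
    refine absurd (he w v hle) (not_le.mpr (Set.ncard_lt_ncard ⟨?_, ?_⟩ (Set.toFinite _)))
    · rintro H ⟨hH, hvH⟩
      refine ⟨hH, fun hwH => ?_⟩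
      rcases hFs.nested _ hF G H hG hH (fun h => hw (h ▸ hwF)) (fun h => hvH (h ▸ hvF))
        with h | h
      · exact hvH (Finset.mem_inter.mp (h (Finset.mem_inter.mpr ⟨hvF, hv⟩))).2
      · exact hw (Finset.mem_inter.mp (h (Finset.mem_inter.mpr ⟨hwF, hwH⟩))).2
    · exact fun hs => (hs (⟨hG, hw⟩ : G ∈ {H | IsFacet Δ H ∧ w ∉ H})).2 hv
  let below : V → Finset V := fun v => Finset.univ.filter fun w => col w = col v ∧ e w < e v
  let column : Fin n → Finset V := fun i => Finset.univ.filter fun w => col w = i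
  have hbelow : ∀ v w, col v = col w → e v < e w → (below v).card < (below w).card := by
    intro v w hc hlt
    refine Finset.card_lt_card (Finset.ssubset_iff_of_subset ?_ |>.mpr ⟨v, ?_, ?_⟩)
    · intro x hx
      simp only [below, Finset.mem_filter, Finset.mem_univ, true_and] at hx ⊢
      exact ⟨hx.1.trans hc, hx.2.trans hlt⟩
    · simp [below, hc, hlt]
    · simp [below]
  have hinj : ∀ v w, col v = col w → (below v).card = (below w).card → v = w := by
    intro v w hc hb
    rcases lt_trichotomy (e v) (e w) with hlt | heq | hlt
    · exact absurd hb (hbelow v w hc hlt).ne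
    · exact e.injective heq
    · exact absurd hb (hbelow w v hc.symm hlt).ne'
  have hlt : ∀ v, (below v).card < (column (col v)).card := by
    intro v
    refine Finset.card_lt_card (Finset.ssubset_iff_of_subset ?_ |>.mpr ⟨v, ?_, ?_⟩)
    · intro x hx
      simp only [below, column, Finset.mem_filter, Finset.mem_univ, true_and] at hx ⊢
      exact hx.1
    · simp [column]
    · simp [below]
  refine ⟨n, fun v => (col v, (below v).card), fun i => (column i).card,
    fun G i => (G.filter fun w => col w = i).card, ?_, ?_, ?_, ?_, ?_⟩
  · intro v w hvw
    rw [Prod.mk.injEq] at hvw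
    exact hinj v w hvw.1 hvw.2
  · intro i j hj
    have himg : (column i).image (fun v => (below v).card) = Finset.range (column i).card := by
      refine Finset.eq_of_subset_of_card_le ?_ ?_
      · intro x hx
        obtain ⟨v, hv, rfl⟩ := Finset.mem_image.mp hx
        have hv' : col v = i := by simpa [column] using hv
        exact Finset.mem_range.mpr (hv' ▸ hlt v)
      · rw [Finset.card_range, Finset.card_image_of_injOn]
        intro v hv w hw hvw
        have hv' : col v = i := by simpa [column] using hv
        have hw' : col w = i := by simpa [column] using hw
        exact hinj v w (hv'.trans hw'.symm) hvw
    have hj' := Finset.mem_range.mpr hj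
    rw [← himg] at hj'
    obtain ⟨v, hv, hvj⟩ := Finset.mem_image.mp hj'
    exact ⟨v, Prod.ext (by simpa [column] using hv) hvj⟩
  · exact fun G i => Finset.card_le_card (Finset.filter_subset_filter _ (Finset.subset_univ _))
  · intro G hG v
    constructor
    · intro hv
      refine Finset.card_lt_card (Finset.ssubset_iff_of_subset ?_ |>.mpr ⟨v, ?_, ?_⟩)
      · intro x hx
        simp only [below, Finset.mem_filter, Finset.mem_univ, true_and] at hx ⊢
        exact ⟨hdown G hG v x hv hx.1 hx.2.le, hx.1⟩
      · simp [hv]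
      · simp [below]
    · intro hv
      by_contra hvG
      refine absurd hv (not_lt.mpr (Finset.card_le_card fun x hx => ?_))
      simp only [below, Finset.mem_filter, Finset.mem_univ, true_and] at hx ⊢
      refine ⟨hx.2, ?_⟩
      by_contra hxv
      exact hvG (hdown G hG x v hx.1 hx.2.symm (not_lt.mp hxv))
  · intro i
    exact ⟨(ε.symm i).1, hFs.isFacet _ (ε.symm i).2, fun v => hcol v i⟩

namespace IsColumnArrangement

variable {pos : V → Fin n × ℕ} {m : Fin n → ℕ} {h : Finset V → Fin n → ℕ}

omit [DecidableEq V] in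
lemma subset_iff (H : IsColumnArrangement Δ pos m h) {G : Finset V} (hG : IsFacet Δ G)
    {W : Finset V} : G ⊆ W ↔ ∀ v, (pos v).2 < h G (pos v).1 → v ∈ W :=
  forall_congr' fun v => by rw [H.mem_iff G hG]

omit [DecidableEq V] in
lemma eq_of_height_le (H : IsColumnArrangement Δ pos m h) {G G' : Finset V} (hG : IsFacet Δ G)
    (hG' : IsFacet Δ G') (hle : h G ≤ h G') : G = G' :=
  hG.eq_of_subset hG' ((H.subset_iff hG).mpr fun v hv =>
    (H.mem_iff G' hG' v).mpr (hv.trans_le (hle _)))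

omit [DecidableEq V] in
lemma pos_lt (H : IsColumnArrangement Δ pos m h) (v : V) : (pos v).2 < m (pos v).1 := by
  obtain ⟨F, hF, hcol⟩ := H.exists_column (pos v).1
  exact ((H.mem_iff F hF v).mp ((hcol v).mpr rfl)).trans_le (H.height_le F _)

omit [DecidableEq V] in
/-- The exponent belonging to the `i`-th column is `m i` times the `i`-th unit vector. -/
lemma exists_height_eq_single (H : IsColumnArrangement Δ pos m h) (i : Fin n) :
    ∃ F, IsFacet Δ F ∧ h F = Pi.single i (m i) := by
  obtain ⟨F, hF, hcol⟩ := H.exists_column i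
  refine ⟨F, hF, funext fun l => ?_⟩
  have key : ∀ j, j < m l → (j < h F l ↔ l = i) := by
    intro j hj
    obtain ⟨v, hv⟩ := H.exists_pos_eq l j hj
    have h1 := H.mem_iff F hF v
    rw [hcol, hv] at h1
    exact h1.symm
  by_cases hl : l = i
  · subst hl
    rw [Pi.single_eq_same]
    refine le_antisymm (H.height_le F l) (not_lt.mp fun hlt => ?_)
    exact lt_irrefl _ ((key _ hlt).mpr rfl)
  · rw [Pi.single_eq_of_ne hl]
    by_contra h0
    have h1 := Nat.pos_of_ne_zero h0
    exact hl ((key 0 (h1.trans_le (H.height_le F l))).mp h1)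

end IsColumnArrangement

end Coordinates

/-! ### Facet rings of column arrangements -/

section CohenMacaulay

open MvPolynomial

variable {V : Type*} {Δ : LowerSet (Finset V)} {n : ℕ}
variable {pos : V → Fin n × ℕ} {m : Fin n → ℕ} {h : Finset V → Fin n → ℕ}

/-- The difference between the variable at place `(i, j)` and the one at the bottom of the `i`-th
column, as an element of the polynomial ring in these differences. -/
noncomputable def columnOffset (k : Type*) [Field k] (pos : V → Fin n × ℕ) (v : V) :
    MvPolynomial {v // (pos v).2 ≠ 0} k :=
  if hv : (pos v).2 ≠ 0 then X ⟨v, hv⟩ else 0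

lemma isCohenMacaulay_of_ringEquiv_of_finite_of_free (k : Type*) [Field k] (σ : Type*) [Finite σ]
    {B Q : Type*} [CommRing B] [CommRing Q] [Algebra (MvPolynomial σ k) Q]
    [Module.Finite (MvPolynomial σ k) Q] [Module.Free (MvPolynomial σ k) Q] (E : B ≃+* Q) :
    IsCohenMacaulay B := by
  let : Algebra (MvPolynomial σ k) B :=
    (E.symm.toRingHom.comp (algebraMap (MvPolynomial σ k) Q)).toAlgebra
  let L : Q ≃ₗ[MvPolynomial σ k] B :=
    { E.symm with
      map_smul' := fun p x => by
        simp only [Algebra.smul_def]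
        exact map_mul E.symm _ _ }
  have := Module.Finite.equiv L
  have := Module.Free.of_equiv L
  exact isCohenMacaulay_of_finite_of_flat k σ B

/-- In the coordinates given by the bottom variables `x_i` of the columns and the differences of
the other variables with these, the generators of the facet ideal are Newton polynomials in the
`x_i` over the polynomial ring in the differences. Hence the quotient is finite and free over the
latter. -/
theorem IsColumnArrangement.isCohenMacaulay [Fintype V] (H : IsColumnArrangement Δ pos m h)
    (hne : ∀ F, IsFacet Δ F → F.Nonempty) (k : Type*) [Field k] :
    IsCohenMacaulay (MvPolynomial V k ⧸ facetIdeal k Δ) := by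
  classical
  have hm : ∀ i, 0 < m i := by
    intro i
    obtain ⟨F, hF, hcol⟩ := H.exists_column i
    obtain ⟨v, hv⟩ := hne F hF
    have := H.pos_lt v
    rw [(hcol v).mp hv] at this
    omega
  choose vert hvert using H.exists_pos_eq
  have hvert' : ∀ v (hv : (pos v).2 < m (pos v).1), vert (pos v).1 (pos v).2 hv = v :=
    fun v hv => H.injective (hvert _ _ _)
  set P := MvPolynomial {v // (pos v).2 ≠ 0} k with hP
  let base : Fin n → V := fun i => vert i 0 (hm i)
  let off : V → P := columnOffset k pos
  let b : Fin n → ℕ → P := fun i j => if hj : j < m i then off (vert i j hj) else 0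
  let U : Set (Fin n → ℕ) := {u | ∃ G, IsFacet Δ G ∧ h G ≤ u}
  have hU : IsUpperSet U := fun u u' hle ⟨G, hG, hGu⟩ => ⟨G, hG, hGu.trans hle⟩
  have hUfin : Uᶜ.Finite := by
    refine (Set.finite_Iic m).subset fun u hu i => ?_
    by_contra! hlt
    obtain ⟨F, hF, hFi⟩ := H.exists_height_eq_single i
    refine hu ⟨F, hF, ?_⟩
    rw [hFi]
    intro l
    by_cases hl : l = i
    · subst hl
      simpa using hlt.le
    · simp [hl]
  obtain ⟨hfinite, hfree⟩ := finite_and_free_quotient_span_newtonPoly b hU hUfin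
  let θ : P →+* MvPolynomial V k := eval₂Hom C fun v => X v.1 - X (base (pos v.1).1)
  let f : MvPolynomial V k →+* MvPolynomial (Fin n) P :=
    eval₂Hom (C.comp C) fun v => X (pos v).1 + C (off v)
  let g : MvPolynomial (Fin n) P →+* MvPolynomial V k :=
    eval₂Hom θ fun i => X (base i)
  have hbase : ∀ i, pos (base i) = (i, 0) := fun i => hvert _ _ _
  have hfC : ∀ a, f (C a) = C (C a) := fun a => eval₂Hom_C _ _ _
  have hfX : ∀ v, f (X v) = X (pos v).1 + C (off v) := fun v => eval₂Hom_X' _ _ _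
  have hθC : ∀ a, θ (C a) = C a := fun a => eval₂Hom_C _ _ _
  have hθX : ∀ v, θ (X v) = X v.1 - X (base (pos v.1).1) := fun v => eval₂Hom_X' _ _ _
  have hgC : ∀ p, g (C p) = θ p := fun p => eval₂Hom_C _ _ _
  have hgX : ∀ i, g (X i) = X (base i) := fun i => eval₂Hom_X' _ _ _
  have hoff0 : ∀ i, off (base i) = 0 := fun i => by simp [off, columnOffset, hbase]
  have hfg : f.comp g = RingHom.id _ := by
    refine ringHom_ext (fun p => ?_) fun i => ?_
    · have : (f.comp g).comp C = (C : P →+* MvPolynomial (Fin n) P) := by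
        refine ringHom_ext (fun a => ?_) fun v => ?_
        · rw [RingHom.comp_apply, RingHom.comp_apply, hgC, hθC, hfC]
        · have : off v.1 = X v := by simp [off, columnOffset, v.2]
          rw [RingHom.comp_apply, RingHom.comp_apply, hgC, hθX, map_sub, hfX, hfX, hoff0, hbase,
            this, C_0, add_zero, add_sub_cancel_left]
      exact RingHom.congr_fun this p
    · rw [RingHom.comp_apply, hgX, hfX, hoff0, hbase, C_0, add_zero, RingHom.id_apply]
  have hgf : g.comp f = RingHom.id _ := by
    refine ringHom_ext (fun a => ?_) fun v => ?_
    · rw [RingHom.comp_apply, hfC, hgC, hθC, RingHom.id_apply]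
    · rw [RingHom.comp_apply, hfX, RingHom.id_apply, map_add, hgX, hgC]
      by_cases hv : (pos v).2 = 0
      · have h1 : off v = 0 := by simp [off, columnOffset, hv]
        have h2 : base (pos v).1 = v := H.injective (by rw [hbase, ← hv])
        rw [h1, h2, map_zero, add_zero]
      · have h1 : off v = X ⟨v, hv⟩ := by simp [off, columnOffset, hv]
        rw [h1, hθX, add_sub_cancel]
  -- the change of coordinates
  let e : MvPolynomial V k ≃+* MvPolynomial (Fin n) P := RingEquiv.ofRingHom f g hfg hgf
  have hfprod : ∀ G, IsFacet Δ G → f (∏ v ∈ G, X v) = newtonPoly b (h G) := by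
    intro G hG
    rw [map_prod, newtonPoly, Finset.prod_sigma']
    refine Finset.prod_bij (fun v _ => ⟨(pos v).1, (pos v).2⟩) ?_ ?_ ?_ ?_
    · intro v hv
      simpa using (H.mem_iff G hG v).mp hv
    · intro v _ w _ hvw
      rw [Sigma.mk.injEq] at hvw
      exact H.injective (Prod.ext hvw.1 (eq_of_heq hvw.2))
    · rintro ⟨i, j⟩ hij
      simp only [Finset.mem_sigma, Finset.mem_univ, Finset.mem_range, true_and] at hij
      obtain ⟨v, hv⟩ := H.exists_pos_eq i j (hij.trans_le (H.height_le G i))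
      exact ⟨v, (H.mem_iff G hG v).mpr (by rwa [hv]), by rw [hv]⟩
    · intro v _
      rw [hfX]
      simp only [b, dif_pos (H.pos_lt v), hvert']
  have hmap : Ideal.span (newtonPoly b '' U) = (facetIdeal k Δ).map (e : _ →+* _) := by
    rw [facetIdeal, Ideal.map_span]
    refine le_antisymm (Ideal.span_le.mpr ?_) (Ideal.span_mono ?_)
    · rintro _ ⟨u, ⟨G, hG, hGu⟩, rfl⟩
      exact Ideal.mem_of_dvd _ (newtonPoly_dvd b hGu)
        (Ideal.subset_span ⟨_, ⟨G, hG, rfl⟩, hfprod G hG⟩)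
    · rintro _ ⟨_, ⟨G, hG, rfl⟩, rfl⟩
      exact ⟨h G, ⟨G, hG, le_rfl⟩, (hfprod G hG).symm⟩
  let E : (MvPolynomial V k ⧸ facetIdeal k Δ) ≃+*
      (MvPolynomial (Fin n) P ⧸ Ideal.span (newtonPoly b '' U)) :=
    Ideal.quotientEquiv _ _ e hmap
  exact isCohenMacaulay_of_ringEquiv_of_finite_of_free k {v // (pos v).2 ≠ 0} E

end CohenMacaulay

/-! ### Monomial ideals and polarization -/

section MonomialIdeals

open MvPolynomial

variable {k : Type*} [Field k]

/-- Evaluation at the indicator of `F` separates `∏ v ∈ F, X v` from the square-free monomials that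
do not divide it. -/
lemma prod_X_mem_span_iff {σ : Type*} {𝒮 : Set (Finset σ)} {F : Finset σ} :
    ∏ v ∈ F, (X v : MvPolynomial σ k) ∈ Ideal.span ((fun S => ∏ v ∈ S, X v) '' 𝒮) ↔
      ∃ S ∈ 𝒮, S ⊆ F := by
  classical
  constructor
  · intro hF
    by_contra! hS
    let φ : MvPolynomial σ k →+* k := eval fun v => if v ∈ F then 1 else 0
    have h1 : Ideal.span ((fun S => ∏ v ∈ S, X v) '' 𝒮) ≤ RingHom.ker φ := by
      rw [Ideal.span_le]
      rintro _ ⟨S, hS', rfl⟩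
      obtain ⟨v, hv, hvF⟩ := Finset.not_subset.mp (hS S hS')
      simp only [SetLike.mem_coe, RingHom.mem_ker, φ, map_prod, eval_X]
      exact Finset.prod_eq_zero hv (if_neg hvF)
    have h2 : φ (∏ v ∈ F, X v) = 1 := by
      simp only [φ, map_prod, eval_X]
      exact Finset.prod_eq_one fun v hv => if_pos hv
    exact one_ne_zero (h2.symm.trans (RingHom.mem_ker.mp (h1 hF)))
  · rintro ⟨S, hS, hSF⟩
    exact Ideal.mem_of_dvd _ (Finset.prod_dvd_prod_of_subset _ _ _ hSF)
      (Ideal.subset_span ⟨S, hS, rfl⟩)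

lemma mem_stanleyReisnerComplex_polarization {n : ℕ} {I : Ideal (MvPolynomial (Fin n) k)}
    {F : Finset (PolarizationVar I)} :
    F ∈ stanleyReisnerComplex (polarization I) ↔
      ∀ m ∈ minimalGenerators I, ∃ w : PolarizationVar I, w.1.2 < m w.1.1 ∧ w ∉ F := by
  classical
  let seg : minimalGenerators I → Finset (PolarizationVar I) := fun m =>
    (Finset.univ : Finset (Σ i : Fin n, Fin (m.1 i))).map
      ⟨fun x => ⟨(x.1, x.2), m.1, m.2, x.2.2⟩, by
        rintro ⟨i, j⟩ ⟨i', j'⟩ hij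
        simp only [Subtype.mk.injEq, Prod.mk.injEq] at hij
        obtain ⟨rfl, hj⟩ := hij
        rw [Fin.ext hj]⟩
  have hseg : ∀ m w, w ∈ seg m ↔ w.1.2 < m.1 w.1.1 := by
    rintro m ⟨⟨i, j⟩, hw⟩
    simp only [seg, Finset.mem_map, Finset.mem_univ, true_and]
    constructor
    · rintro ⟨x, hx⟩
      obtain ⟨rfl, rfl⟩ := Prod.mk.inj (congrArg Subtype.val hx)
      exact x.2.2
    · exact fun hj => ⟨⟨i, ⟨j, hj⟩⟩, rfl⟩
  have hpol : polarization I = Ideal.span ((fun S => ∏ v ∈ S, X v) '' Set.range seg) := by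
    rw [polarization, ← Set.range_comp]
    congr 2
    funext m
    simp only [Function.comp_apply, seg, Finset.prod_map]
    rw [polarizationMonomial, Fintype.prod_sigma]
    rfl
  change _ ∉ _ ↔ _
  rw [hpol, prod_X_mem_span_iff]
  simp only [Set.exists_range_iff, not_exists, Finset.not_subset, hseg, Subtype.forall]

lemma monomial_mem_span_iff {σ : Type*} {S : Set (σ →₀ ℕ)} {a : σ →₀ ℕ} :
    monomial a (1 : k) ∈ Ideal.span ((fun m => monomial m (1 : k)) '' S) ↔ ∃ s ∈ S, s ≤ a := by
  classical
  rw [mem_ideal_span_monomial_image]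
  simp [support_monomial]

lemma monomial_mem_of_le {σ : Type*} {I : Ideal (MvPolynomial σ k)} {a b : σ →₀ ℕ} (hab : a ≤ b)
    (ha : monomial a (1 : k) ∈ I) : monomial b (1 : k) ∈ I :=
  I.mem_of_dvd (monomial_dvd_monomial.mpr ⟨Or.inr hab, one_dvd _⟩) ha

lemma minimal_of_mem_minimalGenerators {σ : Type*} {I : Ideal (MvPolynomial σ k)} {a : σ →₀ ℕ}
    (ha : a ∈ minimalGenerators I) : Minimal (fun m => monomial m (1 : k) ∈ I) a := ha

lemma exists_minimalGenerators_le {n : ℕ} {I : Ideal (MvPolynomial (Fin n) k)} {a : Fin n →₀ ℕ}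
    (ha : monomial a (1 : k) ∈ I) : ∃ m ∈ minimalGenerators I, m ≤ a := by
  obtain ⟨m, hle, hm⟩ :=
    exists_minimal_le_of_wellFoundedLT (fun m => monomial m (1 : k) ∈ I) a ha
  exact ⟨m, hm, hle⟩

/-- Modulo `I` the powers of `X i` satisfy `X i ^ N = X i ^ (N + 1) * q` for some `N` and `q`, and
`X i ^ N` is a term of the difference of both sides. -/
lemma IsMonomialIdeal.exists_monomial_single_mem {σ : Type*} {I : Ideal (MvPolynomial σ k)}
    (hI : IsMonomialIdeal I) [IsArtinianRing (MvPolynomial σ k ⧸ I)] (i : σ) :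
    ∃ N, monomial (Finsupp.single i N) (1 : k) ∈ I := by
  classical
  obtain ⟨N, y, hy⟩ := IsArtinian.exists_pow_succ_smul_dvd
    (Ideal.Quotient.mk I (X i)) (1 : MvPolynomial σ k ⧸ I)
  obtain ⟨q, rfl⟩ := Ideal.Quotient.mk_surjective y
  refine ⟨N, ?_⟩
  have hmem : X i ^ (N + 1) * q - X i ^ N ∈ I := by
    rw [← Ideal.Quotient.eq]
    simpa [smul_eq_mul] using hy
  obtain ⟨S, rfl⟩ := hI
  rw [monomial_mem_span_iff]
  refine mem_ideal_span_monomial_image.mp hmem _ ?_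
  have h1 : coeff (Finsupp.single i N) (X i ^ (N + 1) * q) = 0 := by
    rw [X_pow_eq_monomial, coeff_monomial_mul', if_neg]
    intro hle
    simpa using hle i
  rw [mem_support_iff, coeff_sub, h1, X_pow_eq_monomial, coeff_monomial, if_pos rfl]
  simp

lemma isArtinianRing_quotient_of_pow_mem {σ : Type*} [Finite σ] {I : Ideal (MvPolynomial σ k)}
    (h : ∀ i, ∃ N, N ≠ 0 ∧ (X i : MvPolynomial σ k) ^ N ∈ I) :
    IsArtinianRing (MvPolynomial σ k ⧸ I) := by
  have : Algebra.IsIntegral k (MvPolynomial σ k ⧸ I) := by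
    refine ⟨fun x => ?_⟩
    obtain ⟨p, rfl⟩ := Ideal.Quotient.mk_surjective x
    induction p using MvPolynomial.induction_on with
    | C a => exact isIntegral_algebraMap (R := k) (A := MvPolynomial σ k ⧸ I) (x := a)
    | add p q hp hq => rw [map_add]; exact hp.add hq
    | mul_X p i hp =>
      obtain ⟨N, hN, hi⟩ := h i
      rw [map_mul]
      refine hp.mul (IsIntegral.of_pow (Nat.pos_of_ne_zero hN) ?_)
      rw [← map_pow, Ideal.Quotient.eq_zero_iff_mem.mpr hi]
      exact isIntegral_zero
  have : Module.Finite k (MvPolynomial σ k ⧸ I) := Algebra.IsIntegral.finite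
  exact IsArtinianRing.of_finite k _

end MonomialIdeals

/-! ### Generalized Bier balls -/

section BierBalls

open MvPolynomial

variable {V : Type*} {n : ℕ}

/-- The facets of `Δ` are the polarizations of the monomials with exponents `h G`. -/
theorem IsColumnArrangement.isGeneralizedBierBall_ind {Δ : LowerSet (Finset V)}
    {pos : V → Fin n × ℕ} {m : Fin n → ℕ} {h : Finset V → Fin n → ℕ}
    (H : IsColumnArrangement Δ pos m h) (hne : ∀ F, IsFacet Δ F → F.Nonempty)
    (k : Type*) [Field k] : IsGeneralizedBierBall k (Ind Δ) := by
  classical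
  let ex : (Fin n → ℕ) → Fin n →₀ ℕ := Finsupp.equivFunOnFinite.symm
  let S : Set (Fin n →₀ ℕ) := {a | ∃ G, IsFacet Δ G ∧ a = ex (h G)}
  let I : Ideal (MvPolynomial (Fin n) k) := Ideal.span ((fun m => monomial m (1 : k)) '' S)
  have hI : ∀ a, monomial a (1 : k) ∈ I ↔ ∃ G, IsFacet Δ G ∧ h G ≤ a := by
    intro a
    rw [monomial_mem_span_iff]
    constructor
    · rintro ⟨_, ⟨G, hG, rfl⟩, hle⟩
      exact ⟨G, hG, hle⟩
    · rintro ⟨G, hG, hle⟩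
      exact ⟨_, ⟨G, hG, rfl⟩, hle⟩
  have hmin : ∀ a, a ∈ minimalGenerators I ↔ ∃ G, IsFacet Δ G ∧ a = ex (h G) := by
    intro a
    constructor
    · intro ha
      obtain ⟨G, hG, hle⟩ := (hI a).mp (minimal_of_mem_minimalGenerators ha).prop
      exact ⟨G, hG, ((minimal_of_mem_minimalGenerators ha).eq_of_le
        ((hI _).mpr ⟨G, hG, le_rfl⟩) hle).symm⟩
    · rintro ⟨G, hG, rfl⟩
      refine ⟨(hI _).mpr ⟨G, hG, le_rfl⟩, fun b hb hle => ?_⟩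
      obtain ⟨G', hG', hle'⟩ := (hI b).mp hb
      obtain rfl := H.eq_of_height_le hG' hG (hle'.trans hle)
      exact hle'
  have hart : IsArtinianRing (MvPolynomial (Fin n) k ⧸ I) := by
    refine isArtinianRing_quotient_of_pow_mem fun i => ⟨m i, ?_, ?_⟩
    · obtain ⟨F, hF, hcol⟩ := H.exists_column i
      obtain ⟨v, hv⟩ := hne F hF
      have := H.pos_lt v
      rw [(hcol v).mp hv] at this
      omega
    · obtain ⟨F, hF, hFi⟩ := H.exists_height_eq_single i
      rw [X_pow_eq_monomial, hI]
      refine ⟨F, hF, ?_⟩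
      rw [hFi, Finsupp.single_eq_pi_single]
  have hvalid : ∀ v, ∃ a ∈ minimalGenerators I, (pos v).2 < a (pos v).1 := by
    intro v
    obtain ⟨F, hF, hFi⟩ := H.exists_height_eq_single (pos v).1
    refine ⟨_, (hmin _).mpr ⟨F, hF, rfl⟩, ?_⟩
    change (pos v).2 < h F (pos v).1
    rw [hFi, Pi.single_eq_same]
    exact H.pos_lt v
  let e : V ≃ PolarizationVar I := Equiv.ofBijective (fun v => ⟨pos v, hvalid v⟩) <| by
    refine ⟨fun v w hvw => H.injective (congrArg Subtype.val hvw), ?_⟩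
    rintro ⟨⟨i, j⟩, a, ha, hja⟩
    obtain ⟨G, hG, rfl⟩ := (hmin a).mp ha
    obtain ⟨v, hv⟩ := H.exists_pos_eq i j (hja.trans_le (H.height_le G i))
    exact ⟨v, Subtype.ext hv⟩
  refine ⟨n, I, ⟨S, rfl⟩, hart, e, fun F => ?_⟩
  rw [mem_stanleyReisnerComplex_polarization]
  change (∀ G, IsFacet Δ G → ¬ G ⊆ F) ↔ _
  have key : ∀ G, IsFacet Δ G →
      (¬ G ⊆ F ↔ ∃ w : PolarizationVar I, w.1.2 < ex (h G) w.1.1 ∧ w ∉ F.map e.toEmbedding) := by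
    intro G hG
    rw [H.subset_iff hG, ← e.exists_congr_right]
    push Not
    simp only [Finset.mem_map_equiv, Equiv.symm_apply_apply]
    rfl
  constructor
  · intro hF a ha
    obtain ⟨G, hG, rfl⟩ := (hmin a).mp ha
    exact (key G hG).mp (hF G hG)
  · exact fun hF G hG => (key G hG).mpr (hF _ ((hmin _).mpr ⟨G, hG, rfl⟩))

/-- The facets of a generalized Bier ball given by `I` are the complements of the sets of the
`x_{i, u i}`, where `x^u` runs through the monomials outside `I`. -/
theorem IsGeneralizedBierBall.isVertexDecomposable [Fintype V] [DecidableEq V] [Nonempty V]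
    {k : Type*} [Field k] {Γ : LowerSet (Finset V)} (hΓ : IsGeneralizedBierBall k Γ) :
    IsVertexDecomposable Γ := by
  classical
  obtain ⟨n, I, hI, hart, e, he⟩ := hΓ
  let ex : (Fin n → ℕ) → Fin n →₀ ℕ := Finsupp.equivFunOnFinite.symm
  have hpure : ∀ i, ∃ t, Finsupp.single i t ∈ minimalGenerators I := by
    intro i
    obtain ⟨N, hN⟩ := hI.exists_monomial_single_mem i
    obtain ⟨a, ha, hle⟩ := exists_minimalGenerators_le hN
    refine ⟨a i, ?_⟩
    have : a = Finsupp.single i (a i) := by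
      ext l
      by_cases hl : l = i
      · subst hl; simp
      · have := hle l
        rw [Finsupp.single_eq_of_ne hl] at this ⊢
        exact Nat.le_zero.mp this
    rwa [← this]
  choose t ht using hpure
  have hle_t : ∀ a ∈ minimalGenerators I, ∀ i, a i ≤ t i := by
    intro a ha i
    by_contra! hlt
    have h1 : Finsupp.single i (t i) ≤ a := by
      rw [Finsupp.single_le_iff]
      exact hlt.le
    have h2 := (minimal_of_mem_minimalGenerators ha).eq_of_le
      (minimal_of_mem_minimalGenerators (ht i)).prop h1
    rw [← h2, Finsupp.single_eq_same] at hlt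
    exact lt_irrefl _ hlt
  have hlt_t : ∀ u : Fin n → ℕ, monomial (ex u) (1 : k) ∉ I → ∀ i, u i < t i := by
    intro u hu i
    by_contra! hle
    refine hu (monomial_mem_of_le ?_ (minimal_of_mem_minimalGenerators (ht i)).prop)
    rw [Finsupp.single_le_iff]
    exact hle
  have hfin : {u : Fin n → ℕ | monomial (ex u) (1 : k) ∉ I}.Finite :=
    (Set.finite_Iic t).subset fun u hu i => (hlt_t u hu i).le
  let A : Finset (Fin n → ℕ) := hfin.toFinset
  have hA : ∀ u, u ∈ A ↔ monomial (ex u) (1 : k) ∉ I := fun u => hfin.mem_toFinset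
  let c : Fin n → ℕ → V := fun i j =>
    if hij : ∃ a ∈ minimalGenerators I, j < a i then e.symm ⟨(i, j), hij⟩
    else Classical.arbitrary V
  have hc : ∀ i j (hij : ∃ a ∈ minimalGenerators I, j < a i), c i j = e.symm ⟨(i, j), hij⟩ :=
    fun i j hij => dif_pos hij
  have hvalid : ∀ u ∈ A, ∀ i, ∃ a ∈ minimalGenerators I, u i < a i := fun u hu i =>
    ⟨_, ht i, by simpa using hlt_t u ((hA u).mp hu) i⟩
  have hstair : IsStaircase Finset.univ c A := by
    refine ⟨fun u hu u' hle => ?_, fun _ _ _ => Finset.mem_univ _, fun u hu u' hu' i i' hii => ?_⟩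
    · rw [hA] at hu ⊢
      exact fun hu' => hu (monomial_mem_of_le hle hu')
    · rw [hc _ _ (hvalid u hu i), hc _ _ (hvalid u' hu' i'), e.symm.injective.eq_iff,
        Subtype.mk.injEq, Prod.mk.injEq] at hii
      exact hii
  have hmem : ∀ F, F ∈ Γ ↔ ∀ a ∈ minimalGenerators I,
      ∃ w : PolarizationVar I, w.1.2 < a w.1.1 ∧ e.symm w ∉ F := by
    intro F
    rw [he, mem_stanleyReisnerComplex_polarization]
    simp only [Finset.mem_map_equiv]
  suffices Γ = staircaseComplex Finset.univ c A from this ▸ hstair.isVertexDecomposable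
  ext F
  change F ∈ Γ ↔ F ∈ staircaseComplex _ _ _
  rw [hmem, mem_staircaseComplex]
  constructor
  · intro hF
    have hex : ∀ i, ∃ j, ∀ hij : ∃ a ∈ minimalGenerators I, j < a i,
        e.symm ⟨(i, j), hij⟩ ∉ F := fun i =>
      ⟨t i, fun ⟨a, ha, hlt⟩ => absurd hlt (not_lt.mpr (hle_t a ha i))⟩
    -- `u i` is the first place of the `i`-th column that is not occupied by `F`
    have hu : (fun i => Nat.find (hex i)) ∈ A := by
      rw [hA]
      intro hu
      obtain ⟨a, ha, hle⟩ := exists_minimalGenerators_le hu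
      obtain ⟨w, hw, hwF⟩ := hF a ha
      exact Nat.find_min (hex w.1.1) (hw.trans_le (hle w.1.1)) fun _ => hwF
    refine ⟨_, hu, fun v hv => Finset.mem_sdiff.mpr ⟨Finset.mem_univ v, fun hv' => ?_⟩⟩
    obtain ⟨i, -, rfl⟩ := Finset.mem_image.mp hv'
    rw [hc _ _ (hvalid _ hu i)] at hv
    exact Nat.find_spec (hex i) _ hv
  · rintro ⟨u, hu, hF⟩ a ha
    have hau : ¬ a ≤ ex u := fun hle => (hA u).mp hu (monomial_mem_of_le hle
      (minimal_of_mem_minimalGenerators ha).prop)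
    obtain ⟨i, hi⟩ : ∃ i, u i < a i := by
      by_contra! hle
      exact hau hle
    refine ⟨⟨(i, u i), a, ha, hi⟩, hi, fun hmemF => ?_⟩
    refine (Finset.mem_sdiff.mp (hF hmemF)).2 (Finset.mem_image.mpr ⟨i, Finset.mem_univ i, ?_⟩)
    exact hc i (u i) ⟨a, ha, hi⟩

end BierBalls

end SimplicialTrees

theorem mainTheorem7 {V : Type*} [Fintype V] [DecidableEq V] (k : Type*) [Field k] :
    (∀ Δ : LowerSet (Finset V), SimplicialTrees.IsSimplicialTree Δ →
      List.TFAE [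
        SimplicialTrees.IsUnmixed Δ,
        SimplicialTrees.IsCohenMacaulay
          (MvPolynomial V k ⧸ SimplicialTrees.facetIdeal k Δ),
        SimplicialTrees.IsGrafted Δ,
        SimplicialTrees.IsGeneralizedBierBall k (SimplicialTrees.Ind Δ),
        SimplicialTrees.IsVertexDecomposable (SimplicialTrees.Ind Δ)]) ∧
    (∀ G : SimpleGraph V, G.IsTree →
      SimplicialTrees.IsSimplicialTree (SimplicialTrees.graphComplex G)) := by
  refine ⟨fun Δ hΔ => ?_, fun G hG => SimplicialTrees.isSimplicialTree_graphComplex hG⟩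
  have := hΔ.nonempty
  have hne : ∀ F, SimplicialTrees.IsFacet Δ F → F.Nonempty := fun F hF => hΔ.facet_nonempty hF
  tfae_have 1 → 3 := fun h =>
    have ⟨_, hFs⟩ := hΔ.exists_isNestedPartition h
    hFs.isGrafted
  tfae_have 3 → 4 := fun h =>
    have ⟨_, hFs⟩ := h.exists_isNestedPartition hΔ.vertex_mem
    have ⟨_, _, _, _, H⟩ := hFs.exists_isColumnArrangement
    H.isGeneralizedBierBall_ind hne k
  tfae_have 4 → 5 := fun h => h.isVertexDecomposable
  tfae_have 5 → 1 := fun h => SimplicialTrees.isUnmixed_of_isPure_ind h.isPure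
  tfae_have 3 → 2 := fun h =>
    have ⟨_, hFs⟩ := h.exists_isNestedPartition hΔ.vertex_mem
    have ⟨_, _, _, _, H⟩ := hFs.exists_isColumnArrangement
    H.isCohenMacaulay hne k
  tfae_have 2 → 1 := fun h => SimplicialTrees.isUnmixed_of_isCohenMacaulay h
  tfae_finish
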